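/- Let $I=[t_0,t_1]$ with $t_0<t_1$, let $T\supseteq I$ be an open interval, and let $L=L(t,x,y):T\times\mathbb R^n\times\mathbb R^n\to\mathbb R$ be such that $L$ and $L_{\dot x}:=L_y$ are twice continuously differentiable in all variables. Consider $$J(x)=\int_{t_0}^{t_1}L(t,x(t),\dot x(t))\,dt\to\min,\qquad x(t_0)=x_0,\quad x(t_1)=x_1 .$$ Admissible functions are the $x:I\to\mathbb R^n$ satisfying the boundary conditions that are piecewise smooth: $x$ is continuous, and $\dot x$ exists and is continuous on $I$ except at finitely many points of $(t_0,t_1)$, where it has finite one-sided limits (at $t_0,t_1$ derivatives are one-sided). An admissible $\bar x$ is a weak local minimum if for some $\hat\delta>0$ one has $J(x)\ge J(\bar x)$ for all admissible $x$ with $\max\{\|x-\bar x\|_{C(I)},\|\dot x-\dot{\bar x}\|_{L_\infty(I)}\}\le\hat\delta$. For $\lambda\in(0,1)$ and $\xi\in\mathbb R^n$ put $\mu=\lambda/(\lambda-1)$ and $$E(\bar L)(t,\xi)=L(t,\bar x,\dot{\bar x}+\xi)-L(t,\bar x,\dot{\bar x})-L_{\dot x}^T(t,\bar x,\dot{\bar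 x})\,\xi,$$ $$\Delta\bar L_x(t,\xi)=L_x(t,\bar x,\dot{\bar x}+\xi)-L_x(t,\bar x,\dot{\bar x}),\qquad \bar L_{xx}(t,\xi)=L_{xx}(t,\bar x,\dot{\bar x}+\xi),$$ where $\bar x=\bar x(t)$, $\dot{\bar x}=\dot{\bar x}(t)$, and $$Q_i(t,\lambda,\xi)=\lambda^iE(\bar L)(t,\xi)+(1-\lambda^i)E(\bar L)(t,\mu\xi)\quad(i=2,3),$$ $$M_i(t,\lambda,\xi)=\lambda^i\Delta\bar L_x^T(t,\xi)\xi+(1-\lambda)\left(\tfrac12+\lambda\right)^{i-1}\Delta\bar L_x^T(t,\mu\xi)\xi\quad(i=1,2),$$ $$W(\bar L)(t,\lambda,\xi)=\lambda M_1(t,\lambda,\xi)+\frac{d}{dt}Q_2(t,\lambda,\xi),$$ $$G(\bar L)(t,\lambda,\xi)=\lambda^2\xi^T\left[\lambda\bar L_{xx}(t,\xi)+(1-\lambda)\bar L_{xx}(t,\mu\xi)\right]\xi+2\lambda\frac{d}{dt}M_2(t,\lambda,\xi)+\frac{d^2}{dt^2}Q_3(t,\lambda,\xi).$$ The argument $\theta+$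 (resp. $\theta-$) means that $\dot{\bar x}(\theta)$ is replaced by its right (resp. left) limit at $\theta$ and that the $t$-derivatives at $\theta$ are right (resp. left) derivatives. Let $B_\delta\subset\mathbb R^n$ be the closed ball of radius $\delta$ centred at $0$. **Theorem.** Let $\bar x$ be a weak local minimum. Then there is $\delta>0$ (depending on neither $\theta$, $\eta$ nor $\bar\lambda$) such that the following hold for all $\bar\lambda\in(0,1)$ and all $\eta\in\mathbb R^n$ with $\eta\in B_\delta$ and $\frac{\bar\lambda}{\bar\lambda-1}\eta\in B_\delta$. (j) If $\theta\in[t_0,t_1)$, $\bar x$ is triply differentiable (on the right at $\theta$) in some semi-neighbourhood $[\theta,\theta+\alpha)\subset I$, $\alpha>0$, and $$E(\bar L)(\theta+,\eta)=E(\bar L)\left(\theta+,\tfrac{\bar\lambda}{\bar\lambda-1}\eta\right)=0,\qquad W(\bar L)(\theta+,\bar\lambda,\eta)=0,$$ then $G(\bar L)(\theta+,\bar\lambda,\eta)\ge0$. Likewise, if $\theta\in(t_0,t_1]$, $\bar x$ is triply differentiable (on the left at $\theta$) in some $(\theta-\alpha,\theta]\subset I$, $\alpha>0$, and $$E(\bar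 L)(\theta-,\eta)=E(\bar L)\left(\theta-,\tfrac{\bar\lambda}{\bar\lambda-1}\eta\right)=0,\qquad W(\bar L)(\theta-,\bar\lambda,\eta)=0,$$ then $G(\bar L)(\theta-,\bar\lambda,\eta)\ge0$. (jj) If $\theta\in(t_0,t_1)$, $\bar x$ is triply differentiable at $\theta$, and $$E(\bar L)(\theta,\eta)=E(\bar L)\left(\theta,\tfrac{\bar\lambda}{\bar\lambda-1}\eta\right)=0,$$ then $G(\bar L)(\theta,\bar\lambda,\eta)\ge0$. -/

import Mathlib

open Set Filter Topology MeasureTheory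

noncomputable section

namespace CalcVar

/-- `n`-dimensional Euclidean space. -/
abbrev Rn (n : ℕ) : Type := EuclideanSpace ℝ (Fin n)

variable {n : ℕ}

/-! ### Partial derivatives of an integrand `L(t, x, y)`, where `y` stands for `ẋ` -/

/-- The row vector `L_xᵀ(t,x,y)`, as a linear functional. -/
def Lx (L : ℝ → Rn n → Rn n → ℝ) (t : ℝ) (x y : Rn n) : Rn n →L[ℝ] ℝ :=
  fderiv ℝ (fun z => L t z y) x

/-- The row vector `L_ẋᵀ(t,x,y)`, as a linear functional. -/
def Ly (L : ℝ → Rn n → Rn n → ℝ) (t : ℝ) (x y : Rn n) : Rn n →L[ℝ] ℝ :=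
  fderiv ℝ (fun z => L t x z) y

/-- The Hessian `L_xx(t,x,y)`, as a bilinear form: `Lxx L t x y ξ ζ = ζᵀ L_xx(t,x,y) ξ`. -/
def Lxx (L : ℝ → Rn n → Rn n → ℝ) (t : ℝ) (x y : Rn n) : Rn n →L[ℝ] Rn n →L[ℝ] ℝ :=
  fderiv ℝ (fun z => Lx L t z y) x

/-- `L` and `L_ẋ` are twice continuously differentiable in the totality of the variables
`(t,x,y) ∈ T × ℝⁿ × ℝⁿ`. -/
def SmoothIntegrand (T : Set ℝ) (L : ℝ → Rn n → Rn n → ℝ) : Prop :=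
  ContDiffOn ℝ 2 (fun p : ℝ × Rn n × Rn n => L p.1 p.2.1 p.2.2) (T ×ˢ univ) ∧
  ContDiffOn ℝ 2 (fun p : ℝ × Rn n × Rn n => Ly L p.1 p.2.1 p.2.2) (T ×ˢ univ)

/-! ### The variational problem -/

/-- The class `KC¹(I, ℝⁿ)`, `I = [t₀,t₁]`: `x` is continuous on `I`, and outside a finite set
`S ⊆ (t₀,t₁)` it has a continuous derivative (one-sided at `t₀` and `t₁`), which has finite
one-sided limits at each point of `S`. -/
def PiecewiseSmooth (t₀ t₁ : ℝ) (x : ℝ → Rn n) : Prop :=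
  ContinuousOn x (Icc t₀ t₁) ∧
  ∃ S : Finset ℝ, (S : Set ℝ) ⊆ Ioo t₀ t₁ ∧
    (∀ t ∈ Icc t₀ t₁ \ (S : Set ℝ), DifferentiableWithinAt ℝ x (Icc t₀ t₁) t) ∧
    ContinuousOn (derivWithin x (Icc t₀ t₁)) (Icc t₀ t₁ \ (S : Set ℝ)) ∧
    ∀ τ ∈ S,
      (∃ v, Tendsto (derivWithin x (Icc t₀ t₁)) (𝓝[<] τ) (𝓝 v)) ∧
      (∃ v, Tendsto (derivWithin x (Icc t₀ t₁)) (𝓝[>] τ) (𝓝 v))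

/-- Admissible functions: piecewise smooth with `x(t₀) = x₀`, `x(t₁) = x₁`. -/
def Admissible (t₀ t₁ : ℝ) (x₀ x₁ : Rn n) (x : ℝ → Rn n) : Prop :=
  PiecewiseSmooth t₀ t₁ x ∧ x t₀ = x₀ ∧ x t₁ = x₁

/-- The functional `J(x) = ∫_{t₀}^{t₁} L(t, x(t), ẋ(t)) dt`. -/
def J (L : ℝ → Rn n → Rn n → ℝ) (t₀ t₁ : ℝ) (x : ℝ → Rn n) : ℝ :=
  ∫ t in t₀..t₁, L t (x t) (derivWithin x (Icc t₀ t₁) t)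

/-- `xb` is a weak local minimum: it is admissible and, for some `δ > 0`, `J(x) ≥ J(xb)` for all
admissible `x` with `max {‖x - xb‖_C, ‖ẋ - ẋb‖_{L_∞}} ≤ δ`. -/
def WeakLocalMin (L : ℝ → Rn n → Rn n → ℝ) (t₀ t₁ : ℝ) (x₀ x₁ : Rn n) (xb : ℝ → Rn n) : Prop :=
  Admissible t₀ t₁ x₀ x₁ xb ∧
  ∃ δ > 0, ∀ x : ℝ → Rn n, Admissible t₀ t₁ x₀ x₁ x →
    (∀ t ∈ Icc t₀ t₁, ‖x t - xb t‖ ≤ δ) →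
    eLpNorm (fun t => derivWithin x (Icc t₀ t₁) t - derivWithin xb (Icc t₀ t₁) t) ⊤
      (volume.restrict (Icc t₀ t₁)) ≤ ENNReal.ofReal δ →
    J L t₀ t₁ xb ≤ J L t₀ t₁ x

/-! ### Quantities along a function `xb`

The set `s` is an interval on which `t`-derivatives are taken. With `s = [t₀,t₁]` and `t`
interior, they are ordinary derivatives. At `t = θ`, with `s = [θ,t₁]` (resp. `s = [t₀,θ]`) they
are right (resp. left) derivatives, which gives the values at `θ+` (resp. `θ-`): for a piecewise
smooth `xb`, the right derivative at `θ` is the right-hand limit of `ẋb`. -/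

/-- The Weierstrass function `E(L)(t,x,y,z)`. -/
def weierstrass (L : ℝ → Rn n → Rn n → ℝ) (t : ℝ) (x y z : Rn n) : ℝ :=
  L t x z - L t x y - Ly L t x y (z - y)

/-- `E(L̄)(t,ξ)`. -/
def Eb (L : ℝ → Rn n → Rn n → ℝ) (xb : ℝ → Rn n) (s : Set ℝ) (t : ℝ) (ξ : Rn n) : ℝ :=
  weierstrass L t (xb t) (derivWithin xb s t) (derivWithin xb s t + ξ)

/-- `ΔL̄_xᵀ(t,ξ)`. -/
def dLx (L : ℝ → Rn n → Rn n → ℝ) (xb : ℝ → Rn n) (s : Set ℝ) (t : ℝ) (ξ : Rn n) :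
    Rn n →L[ℝ] ℝ :=
  Lx L t (xb t) (derivWithin xb s t + ξ) - Lx L t (xb t) (derivWithin xb s t)

/-- `L̄_xx(t,ξ)`. -/
def Lxxb (L : ℝ → Rn n → Rn n → ℝ) (xb : ℝ → Rn n) (s : Set ℝ) (t : ℝ) (ξ : Rn n) :
    Rn n →L[ℝ] Rn n →L[ℝ] ℝ :=
  Lxx L t (xb t) (derivWithin xb s t + ξ)

/-- `Q_i(L̄)(t,λ,ξ)`, for `i = 1, 2, 3`. -/
def Q (i : ℕ) (L : ℝ → Rn n → Rn n → ℝ) (xb : ℝ → Rn n) (s : Set ℝ) (t lam : ℝ) (ξ : Rn n) : ℝ :=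
  lam ^ i * Eb L xb s t ξ + (1 - lam ^ i) * Eb L xb s t ((lam / (lam - 1)) • ξ)

/-- `M_i(L̄_x)(t,λ,ξ)`, for `i = 1, 2`. -/
def M (i : ℕ) (L : ℝ → Rn n → Rn n → ℝ) (xb : ℝ → Rn n) (s : Set ℝ) (t lam : ℝ) (ξ : Rn n) : ℝ :=
  lam ^ i * dLx L xb s t ξ ξ +
    (1 - lam) * (1 / 2 + lam) ^ (i - 1) * dLx L xb s t ((lam / (lam - 1)) • ξ) ξ

/-- `W(L̄)(θ,λ,ξ) = λ M₁ + (d/dt) Q₂`. -/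
def W (L : ℝ → Rn n → Rn n → ℝ) (xb : ℝ → Rn n) (s : Set ℝ) (θ lam : ℝ) (ξ : Rn n) : ℝ :=
  lam * M 1 L xb s θ lam ξ + derivWithin (fun t => Q 2 L xb s t lam ξ) s θ

/-- `G(L̄)(θ,λ,ξ) = λ² ξᵀ[λ L̄_xx(θ,ξ) + (1-λ) L̄_xx(θ,λξ/(λ-1))]ξ + 2λ (d/dt) M₂ + (d²/dt²) Q₃`. -/
def G (L : ℝ → Rn n → Rn n → ℝ) (xb : ℝ → Rn n) (s : Set ℝ) (θ lam : ℝ) (ξ : Rn n) : ℝ :=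
  lam ^ 2 * (lam * Lxxb L xb s θ ξ ξ ξ
      + (1 - lam) * Lxxb L xb s θ ((lam / (lam - 1)) • ξ) ξ ξ)
    + 2 * lam * derivWithin (fun t => M 2 L xb s t lam ξ) s θ
    + derivWithin (derivWithin (fun t => Q 3 L xb s t lam ξ) s) s θ

/-- The Weierstrass condition degenerates for the vectors `η` and `(λ-1)⁻¹λη`:
`E(L̄)(θ,η) = E(L̄)(θ,(λ-1)⁻¹λη) = 0`. -/
def Degenerate (L : ℝ → Rn n → Rn n → ℝ) (xb : ℝ → Rn n) (s : Set ℝ) (θ lam : ℝ) (η : Rn n) :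
    Prop :=
  Eb L xb s θ η = 0 ∧ Eb L xb s θ ((lam / (lam - 1)) • η) = 0

/-! ### Differentiability of order two and three -/

/-- `x` is twice differentiable at `t`, with derivatives taken along `s`, the first
derivative being `derivWithin x s`. -/
def TwiceDiffAt (x : ℝ → Rn n) (s : Set ℝ) (t : ℝ) : Prop :=
  DifferentiableWithinAt ℝ x s t ∧ DifferentiableWithinAt ℝ (derivWithin x s) s t

/-- `x` is triply differentiable along `s` at each point of `A` (to be used when `A` is a
neighbourhood in `s` of each of its points). -/
def TriplyDiffOn (x : ℝ → Rn n) (s A : Set ℝ) : Prop :=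
  ∀ t ∈ A, TwiceDiffAt x s t ∧
    DifferentiableWithinAt ℝ (derivWithin (derivWithin x s) s) s t

/-- `x` is triply differentiable on the right in a semi-neighbourhood `[θ,θ+α) ⊆ I`. -/
def TriplyDiffRight (t₀ t₁ : ℝ) (x : ℝ → Rn n) (θ : ℝ) : Prop :=
  ∃ α > 0, Ico θ (θ + α) ⊆ Icc t₀ t₁ ∧ TriplyDiffOn x (Icc θ t₁) (Ico θ (θ + α))

/-- `x` is triply differentiable on the left in a semi-neighbourhood `(θ-α,θ] ⊆ I`. -/
def TriplyDiffLeft (t₀ t₁ : ℝ) (x : ℝ → Rn n) (θ : ℝ) : Prop :=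
  ∃ α > 0, Ioc (θ - α) θ ⊆ Icc t₀ t₁ ∧ TriplyDiffOn x (Icc t₀ θ) (Ioc (θ - α) θ)

/-- `x` is triply differentiable at the (interior) point `θ`: `ẋ`, `ẍ` exist near `θ`
and `ẍ` is differentiable at `θ`. -/
def TriplyDiffAt (t₀ t₁ : ℝ) (x : ℝ → Rn n) (θ : ℝ) : Prop :=
  (∀ᶠ t in 𝓝 θ, TwiceDiffAt x (Icc t₀ t₁) t) ∧
    DifferentiableAt ℝ (derivWithin (derivWithin x (Icc t₀ t₁)) (Icc t₀ t₁)) θ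

end CalcVar

end

open Set Filter Topology MeasureTheory

noncomputable section

namespace CalcVar

/-! Perturb `xb` by a triangular function supported in `[θ, θ + ε]`, with slope `η` on the first
fraction `lam` of the interval and slope `(lam / (lam - 1)) • η` on the rest; these slopes make it
vanish at both ends. Scaling the perturbation by `τ ∈ [-1, 1]` keeps the competitor admissible and
close to `xb`, so the first variation vanishes and the increment of `J` equals the integral of
`excess`, the integrand's increment minus its linear part. That integral is therefore nonnegative
(`integral_excess_nonneg`, `integral_excess_tent_nonneg`). No Euler equation and no integration by
parts is needed.

Near `θ` the excess has a second-order Peano expansion (`TriplyDiffAlong.expansion`). Integrating it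
over the two pieces gives `ε Q₁ + ε²/2 W + ε³/6 G + o(ε³)`
(`TriplyDiffAlong.needleIntegral_expansion`), and degeneracy of the Weierstrass condition says that
`Q₁ = 0`. Small `ε > 0` then yields `W ≥ 0`, and `G ≥ 0` once `W = 0`. The mirrored perturbation on
`[θ - ε, θ]` corresponds to `ε < 0` with the integrals reversed: it yields `W ≤ 0`, and again `G ≥
0` once `W = 0`. At a two-sided point both apply, so `W = 0` is automatic.

The three cases of the theorem share one expansion because all derivatives are taken along an
interval `s`, which is `[θ, t₁]`, `[t₀, θ]` or `[t₀, t₁]`. The radius `δ` is the one supplied by the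
weak minimum: a triangular function of length at most one is bounded by its largest slope. -/

/-! ### Partial derivatives as restrictions of the total derivative -/

/-- The inclusion `v ↦ (0, v, 0)`. -/
def inclX (n : ℕ) : Rn n →L[ℝ] ℝ × Rn n × Rn n :=
  (0 : Rn n →L[ℝ] ℝ).prod ((ContinuousLinearMap.id ℝ (Rn n)).prod 0)

/-- The inclusion `v ↦ (0, 0, v)`. -/
def inclY (n : ℕ) : Rn n →L[ℝ] ℝ × Rn n × Rn n :=
  (0 : Rn n →L[ℝ] ℝ).prod ((0 : Rn n →L[ℝ] Rn n).prod (ContinuousLinearMap.id ℝ (Rn n)))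

/-- The integrand as a function on the product space. -/
def uncurried {n : ℕ} (L : ℝ → Rn n → Rn n → ℝ) : ℝ × Rn n × Rn n → ℝ :=
  fun p => L p.1 p.2.1 p.2.2

lemma fderiv_comp_x {n : ℕ} {V : Type*} [NormedAddCommGroup V] [NormedSpace ℝ V]
    {F : ℝ × Rn n × Rn n → V} {t : ℝ} {x y : Rn n} (hF : DifferentiableAt ℝ F (t, x, y)) :
    HasFDerivAt (fun z => F (t, z, y)) ((fderiv ℝ F (t, x, y)).comp (inclX n)) x :=
  HasFDerivAt.comp x (f := fun z => (t, z, y)) hF.hasFDerivAt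
    ((hasFDerivAt_const t x).prodMk ((hasFDerivAt_id x).prodMk (hasFDerivAt_const y x)))

lemma fderiv_comp_y {n : ℕ} {V : Type*} [NormedAddCommGroup V] [NormedSpace ℝ V]
    {F : ℝ × Rn n × Rn n → V} {t : ℝ} {x y : Rn n} (hF : DifferentiableAt ℝ F (t, x, y)) :
    HasFDerivAt (fun z => F (t, x, z)) ((fderiv ℝ F (t, x, y)).comp (inclY n)) y :=
  HasFDerivAt.comp y (f := fun z => (t, x, z)) hF.hasFDerivAt
    ((hasFDerivAt_const t y).prodMk ((hasFDerivAt_const x y).prodMk (hasFDerivAt_id y)))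

lemma Lx_eq {n : ℕ} {L : ℝ → Rn n → Rn n → ℝ} {p : ℝ × Rn n × Rn n}
    (hF : DifferentiableAt ℝ (uncurried L) p) :
    Lx L p.1 p.2.1 p.2.2 = (fderiv ℝ (uncurried L) p).comp (inclX n) :=
  (fderiv_comp_x (F := uncurried L) hF).fderiv

lemma Ly_eq {n : ℕ} {L : ℝ → Rn n → Rn n → ℝ} {p : ℝ × Rn n × Rn n}
    (hF : DifferentiableAt ℝ (uncurried L) p) :
    Ly L p.1 p.2.1 p.2.2 = (fderiv ℝ (uncurried L) p).comp (inclY n) :=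
  (fderiv_comp_y (F := uncurried L) hF).fderiv

lemma fderiv_apply_eq {n : ℕ} {L : ℝ → Rn n → Rn n → ℝ} {p : ℝ × Rn n × Rn n}
    (hF : DifferentiableAt ℝ (uncurried L) p) (v w : Rn n) :
    fderiv ℝ (uncurried L) p (0, v, w) = Lx L p.1 p.2.1 p.2.2 v + Ly L p.1 p.2.1 p.2.2 w := by
  rw [Lx_eq hF, Ly_eq hF, ContinuousLinearMap.comp_apply, ContinuousLinearMap.comp_apply,
    ← map_add]
  simp [inclX, inclY]

/-! ### Piecewise smooth functions -/

lemma nhdsWithin_diff_finset {t₀ t₁ t : ℝ} {S : Finset ℝ} (ht : t ∉ (S : Set ℝ)) :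
    𝓝[Icc t₀ t₁ \ (S : Set ℝ)] t = 𝓝[Icc t₀ t₁] t := by
  rw [sdiff_eq]
  exact nhdsWithin_inter_of_mem'
    (mem_nhdsWithin_of_mem_nhds (S.finite_toSet.isClosed.isOpen_compl.mem_nhds ht))

lemma punctured_mem {t₀ t₁ t : ℝ} (S : Finset ℝ) (ht : t ∈ Ioo t₀ t₁) :
    Icc t₀ t₁ \ (S : Set ℝ) ∈ 𝓝[≠] t := by
  have h1 : Icc t₀ t₁ ∈ 𝓝[≠] t := mem_nhdsWithin_of_mem_nhds (Icc_mem_nhds ht.1 ht.2)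
  have h2 : ((S.erase t : Finset ℝ) : Set ℝ)ᶜ ∈ 𝓝[≠] t :=
    mem_nhdsWithin_of_mem_nhds
      ((S.erase t).finite_toSet.isClosed.isOpen_compl.mem_nhds (by simp))
  filter_upwards [h1, h2, self_mem_nhdsWithin] with u hu1 hu2 hu3
  refine ⟨hu1, fun h => hu2 ?_⟩
  exact Finset.mem_coe.2 (Finset.mem_erase.2 ⟨hu3, h⟩)

/-- The derivative of a piecewise smooth function has one-sided limits at all interior points. -/
lemma oneSided_limits {n : ℕ} {t₀ t₁ τ : ℝ} {f : ℝ → Rn n} {S : Finset ℝ}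
    (hc : ContinuousOn f (Icc t₀ t₁ \ (S : Set ℝ)))
    (hl : ∀ τ ∈ S, (∃ v, Tendsto f (𝓝[<] τ) (𝓝 v)) ∧ (∃ v, Tendsto f (𝓝[>] τ) (𝓝 v)))
    (hτ : τ ∈ Ioo t₀ t₁) :
    (∃ v, Tendsto f (𝓝[<] τ) (𝓝 v)) ∧ (∃ v, Tendsto f (𝓝[>] τ) (𝓝 v)) := by
  by_cases h : τ ∈ S
  · exact hl τ h
  · have h1 : ContinuousAt f τ := by
      have := hc τ ⟨Ioo_subset_Icc_self hτ, by simpa using h⟩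
      rw [ContinuousWithinAt, nhdsWithin_diff_finset (by simpa using h)] at this
      exact ContinuousWithinAt.continuousAt this (Icc_mem_nhds hτ.1 hτ.2)
    exact ⟨⟨_, h1.tendsto.mono_left nhdsWithin_le_nhds⟩,
      ⟨_, h1.tendsto.mono_left nhdsWithin_le_nhds⟩⟩

lemma PiecewiseSmooth.add {n : ℕ} {t₀ t₁ : ℝ} {x z : ℝ → Rn n}
    (hx : PiecewiseSmooth t₀ t₁ x) (hz : PiecewiseSmooth t₀ t₁ z) :
    PiecewiseSmooth t₀ t₁ (fun t => x t + z t) := by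
  obtain ⟨hxc, S, hS, hxd, hxc', hxl⟩ := hx
  obtain ⟨hzc, S', hS', hzd, hzc', hzl⟩ := hz
  have key : ∀ t ∈ Icc t₀ t₁ \ ((S ∪ S' : Finset ℝ) : Set ℝ),
      derivWithin (fun t => x t + z t) (Icc t₀ t₁) t
        = derivWithin x (Icc t₀ t₁) t + derivWithin z (Icc t₀ t₁) t := by
    intro t h
    have h' : t ∉ S ∧ t ∉ S' := by simpa using h.2
    exact derivWithin_fun_add (hxd t ⟨h.1, by simpa using h'.1⟩)
      (hzd t ⟨h.1, by simpa using h'.2⟩)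
  have sub1 : Icc t₀ t₁ \ ((S ∪ S' : Finset ℝ) : Set ℝ) ⊆ Icc t₀ t₁ \ (S : Set ℝ) :=
    sdiff_subset_sdiff_right (by simp)
  have sub2 : Icc t₀ t₁ \ ((S ∪ S' : Finset ℝ) : Set ℝ) ⊆ Icc t₀ t₁ \ (S' : Set ℝ) :=
    sdiff_subset_sdiff_right (by simp)
  refine ⟨hxc.add hzc, S ∪ S', by simpa using ⟨hS, hS'⟩, ?_, ?_, ?_⟩
  · intro t h
    exact (hxd t (sub1 h)).add (hzd t (sub2 h))
  · exact ((hxc'.mono sub1).add (hzc'.mono sub2)).congr key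
  · intro τ hτ
    have hτ' : τ ∈ Ioo t₀ t₁ := by
      rcases Finset.mem_union.1 hτ with h | h
      · exact hS h
      · exact hS' h
    -- A break point of one summand may be a regular point of the other, so limits are needed at
    -- every interior point.
    obtain ⟨⟨a, ha⟩, ⟨b, hb⟩⟩ := oneSided_limits hxc' hxl hτ'
    obtain ⟨⟨a', ha'⟩, ⟨b', hb'⟩⟩ := oneSided_limits hzc' hzl hτ'
    have hp := punctured_mem (S ∪ S') hτ'
    have e : ∀ᶠ t in 𝓝[≠] τ, derivWithin x (Icc t₀ t₁) t + derivWithin z (Icc t₀ t₁) t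
        = derivWithin (fun t => x t + z t) (Icc t₀ t₁) t := by
      filter_upwards [hp] with t h using (key t h).symm
    refine ⟨⟨a + a', (ha.add ha').congr' ?_⟩, ⟨b + b', (hb.add hb').congr' ?_⟩⟩
    · exact e.filter_mono (nhdsWithin_mono _ fun u hu => ne_of_lt hu)
    · exact e.filter_mono (nhdsWithin_mono _ fun u hu => ne_of_gt hu)

lemma PiecewiseSmooth.const_smul {n : ℕ} {t₀ t₁ : ℝ} {x : ℝ → Rn n} (c : ℝ)
    (hx : PiecewiseSmooth t₀ t₁ x) : PiecewiseSmooth t₀ t₁ (fun t => c • x t) := by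
  obtain ⟨hxc, S, hS, hxd, hxc', hxl⟩ := hx
  -- This holds at break points too: scaling commutes with `derivWithin` even where `x` is not
  -- differentiable.
  have e : derivWithin (fun t => c • x t) (Icc t₀ t₁)
      = fun t => c • derivWithin x (Icc t₀ t₁) t := by
    funext t
    exact derivWithin_fun_const_smul_field c x
  refine ⟨hxc.const_smul c, S, hS, fun t h => (hxd t h).const_smul c, ?_, ?_⟩
  · rw [e]; exact hxc'.const_smul c
  · intro τ hτ
    obtain ⟨⟨a, ha⟩, ⟨b, hb⟩⟩ := hxl τ hτ
    rw [e]
    exact ⟨⟨_, ha.const_smul c⟩, ⟨_, hb.const_smul c⟩⟩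

lemma piecewiseSmooth_of_affine {n : ℕ} {t₀ t₁ : ℝ} (ht : t₀ < t₁) {x : ℝ → Rn n} (p v : Rn n)
    (hx : ∀ t ∈ Icc t₀ t₁, x t = p + t • v) : PiecewiseSmooth t₀ t₁ x := by
  have hd : ∀ t ∈ Icc t₀ t₁, HasDerivWithinAt x v (Icc t₀ t₁) t := by
    intro t h
    have h1 : HasDerivAt (fun t : ℝ => p + t • v) v t := by
      simpa using ((hasDerivAt_id t).smul_const v).const_add p
    exact h1.hasDerivWithinAt.congr hx (hx t h)
  have hd' : ∀ t ∈ Icc t₀ t₁, derivWithin x (Icc t₀ t₁) t = v := fun t h =>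
    (hd t h).derivWithin (uniqueDiffOn_Icc ht t h)
  refine ⟨fun t h => (hd t h).continuousWithinAt, ∅, by simp, ?_, ?_, by simp⟩
  · intro t h
    exact (hd t h.1).differentiableWithinAt
  · exact (continuousOn_const (c := v)).congr fun t h => hd' t h.1

/-! ### Ramps, the building blocks of piecewise affine variations. -/

/-- The function `t ↦ (t - c)⁺ v`. -/
def ramp {n : ℕ} (c : ℝ) (v : Rn n) (t : ℝ) : Rn n := max 0 (t - c) • v

lemma ramp_of_le {n : ℕ} {c t : ℝ} (v : Rn n) (h : t ≤ c) : ramp c v t = 0 := by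
  simp [ramp, max_eq_left (sub_nonpos.2 h)]

lemma ramp_of_ge {n : ℕ} {c t : ℝ} (v : Rn n) (h : c ≤ t) : ramp c v t = (t - c) • v := by
  simp [ramp, max_eq_right (sub_nonneg.2 h)]

lemma hasDerivAt_ramp_of_lt {n : ℕ} {c t : ℝ} (v : Rn n) (h : t < c) :
    HasDerivAt (ramp c v) 0 t := by
  refine (hasDerivAt_const t (0 : Rn n)).congr_of_eventuallyEq ?_
  filter_upwards [Iio_mem_nhds h] with u hu using ramp_of_le v (le_of_lt hu)

lemma hasDerivAt_ramp_of_gt {n : ℕ} {c t : ℝ} (v : Rn n) (h : c < t) :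
    HasDerivAt (ramp c v) v t := by
  have h1 : HasDerivAt (fun t : ℝ => (t - c) • v) v t := by
    simpa using ((hasDerivAt_id t).sub_const c).smul_const v
  refine h1.congr_of_eventuallyEq ?_
  filter_upwards [Ioi_mem_nhds h] with u hu using ramp_of_ge v (le_of_lt hu)

lemma piecewiseSmooth_ramp {n : ℕ} {t₀ t₁ : ℝ} (ht : t₀ < t₁) (c : ℝ) (v : Rn n) :
    PiecewiseSmooth t₀ t₁ (ramp c v) := by
  by_cases h0 : c ≤ t₀
  · refine piecewiseSmooth_of_affine ht (-(c • v)) v fun t h => ?_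
    rw [ramp_of_ge v (h0.trans h.1), sub_smul]; abel
  by_cases h1 : t₁ ≤ c
  · refine piecewiseSmooth_of_affine ht 0 0 fun t h => ?_
    rw [ramp_of_le v (h.2.trans h1)]; simp
  push Not at h0 h1
  have hl : ∀ t ∈ Icc t₀ t₁, t < c → derivWithin (ramp c v) (Icc t₀ t₁) t = 0 :=
    fun t h h' => (hasDerivAt_ramp_of_lt v h').hasDerivWithinAt.derivWithin
      (uniqueDiffOn_Icc ht t h)
  have hr : ∀ t ∈ Icc t₀ t₁, c < t → derivWithin (ramp c v) (Icc t₀ t₁) t = v :=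
    fun t h h' => (hasDerivAt_ramp_of_gt v h').hasDerivWithinAt.derivWithin
      (uniqueDiffOn_Icc ht t h)
  refine ⟨?_, {c}, by simpa using ⟨h0, h1⟩, ?_, ?_, ?_⟩
  · exact Continuous.continuousOn (by unfold ramp; fun_prop)
  · rintro t ⟨_, h'⟩
    rcases lt_or_gt_of_ne (by simpa using h' : t ≠ c) with h2 | h2
    · exact (hasDerivAt_ramp_of_lt v h2).differentiableAt.differentiableWithinAt
    · exact (hasDerivAt_ramp_of_gt v h2).differentiableAt.differentiableWithinAt
  · rintro t ⟨_, h'⟩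
    rcases lt_or_gt_of_ne (by simpa using h' : t ≠ c) with h2 | h2
    · refine ContinuousWithinAt.congr_of_eventuallyEq (f := fun _ => 0)
        continuousWithinAt_const ?_ (hl t ‹_› h2)
      filter_upwards [self_mem_nhdsWithin, mem_nhdsWithin_of_mem_nhds (Iio_mem_nhds h2)]
        with u hu hu' using hl u hu.1 hu'
    · refine ContinuousWithinAt.congr_of_eventuallyEq (f := fun _ => v)
        continuousWithinAt_const ?_ (hr t ‹_› h2)
      filter_upwards [self_mem_nhdsWithin, mem_nhdsWithin_of_mem_nhds (Ioi_mem_nhds h2)]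
        with u hu hu' using hr u hu.1 hu'
  · intro τ hτ
    obtain rfl : τ = c := by simpa using hτ
    refine ⟨⟨0, tendsto_const_nhds.congr' ?_⟩, ⟨v, tendsto_const_nhds.congr' ?_⟩⟩
    · filter_upwards [self_mem_nhdsWithin, mem_nhdsWithin_of_mem_nhds (Icc_mem_nhds h0 h1)]
        with u hu hu' using (hl u hu' hu).symm
    · filter_upwards [self_mem_nhdsWithin, mem_nhdsWithin_of_mem_nhds (Icc_mem_nhds h0 h1)]
        with u hu hu' using (hr u hu' hu).symm

/-! ### Boundedness and measurability of piecewise continuous derivatives. -/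

lemma exists_bound_of_nhdsWithin {n : ℕ} {f : ℝ → Rn n} {K : Set ℝ} (hK : IsCompact K)
    (h : ∀ t ∈ K, ∃ C, ∀ᶠ u in 𝓝[K] t, ‖f u‖ ≤ C) : ∃ C, ∀ t ∈ K, ‖f t‖ ≤ C := by
  refine hK.induction_on (p := fun s => ∃ C, ∀ t ∈ s, ‖f t‖ ≤ C) ⟨0, by simp⟩ ?_ ?_ ?_
  · rintro s t hst ⟨C, hC⟩
    exact ⟨C, fun u hu => hC u (hst hu)⟩
  · rintro s t ⟨C, hC⟩ ⟨C', hC'⟩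
    refine ⟨max C C', fun u hu => ?_⟩
    rcases hu with hu | hu
    · exact (hC u hu).trans (le_max_left _ _)
    · exact (hC' u hu).trans (le_max_right _ _)
  · intro t ht
    obtain ⟨C, hC⟩ := h t ht
    exact ⟨_, hC, C, fun u hu => hu⟩

lemma eventually_norm_le {n : ℕ} {l : Filter ℝ} {f : ℝ → Rn n} {v : Rn n}
    (h : Tendsto f l (𝓝 v)) : ∀ᶠ u in l, ‖f u‖ ≤ ‖v‖ + 1 :=
  (h.norm.eventually (Iio_mem_nhds (lt_add_one _))).mono fun _ h => le_of_lt h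

lemma PiecewiseSmooth.exists_bound_derivWithin {n : ℕ} {t₀ t₁ : ℝ} {x : ℝ → Rn n}
    (hx : PiecewiseSmooth t₀ t₁ x) :
    ∃ C, ∀ t ∈ Icc t₀ t₁, ‖derivWithin x (Icc t₀ t₁) t‖ ≤ C := by
  obtain ⟨hxc, S, hS, hxd, hxc', hxl⟩ := hx
  refine exists_bound_of_nhdsWithin isCompact_Icc fun t h => ?_
  by_cases ht : t ∈ S
  · obtain ⟨⟨a, ha⟩, ⟨b, hb⟩⟩ := hxl t ht
    have ha' := eventually_norm_le ha
    have hb' := eventually_norm_le hb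
    -- The last entry covers the value of `derivWithin` at the break point itself, which the
    -- one-sided limits do not control.
    refine ⟨max (max (‖a‖ + 1) (‖b‖ + 1)) ‖derivWithin x (Icc t₀ t₁) t‖, ?_⟩
    refine nhdsWithin_le_nhds ?_
    rw [eventually_nhdsWithin_iff] at ha' hb'
    filter_upwards [ha', hb'] with u h1 h2
    rcases lt_trichotomy u t with h3 | h3 | h3
    · exact (h1 h3).trans ((le_max_left _ _).trans (le_max_left _ _))
    · rw [h3]; exact le_max_right _ _
    · exact (h2 h3).trans ((le_max_right _ _).trans (le_max_left _ _))
  · have h1 := hxc' t ⟨h, by simpa using ht⟩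
    rw [ContinuousWithinAt, nhdsWithin_diff_finset (by simpa using ht)] at h1
    exact ⟨_, eventually_norm_le h1⟩

lemma aestronglyMeasurable_of_continuousOn_diff {V : Type*} [NormedAddCommGroup V]
    {t₀ t₁ : ℝ} {f : ℝ → V} (S : Finset ℝ)
    (hf : ContinuousOn f (Icc t₀ t₁ \ (S : Set ℝ))) :
    AEStronglyMeasurable f (volume.restrict (Icc t₀ t₁)) := by
  have h1 := hf.aestronglyMeasurable_of_isSeparable (μ := volume)
    (measurableSet_Icc.diff S.finite_toSet.measurableSet)
    (TopologicalSpace.IsSeparable.of_separableSpace _)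
  have h2 : (Icc t₀ t₁ \ (S : Set ℝ) : Set ℝ) =ᵐ[volume] Icc t₀ t₁ :=
    sdiff_null_ae_eq_self (S.finite_toSet.measure_zero _)
  rwa [Measure.restrict_congr_set h2] at h1

/-! ### The first variation -/

lemma exists_bound_comp {n : ℕ} {V : Type*} [NormedAddCommGroup V] {T : Set ℝ} {t₀ t₁ : ℝ}
    (hI : Icc t₀ t₁ ⊆ T) {F : ℝ × Rn n × Rn n → V} (hF : ContinuousOn F (T ×ˢ univ)) (R : ℝ) :
    ∃ C, ∀ t ∈ Icc t₀ t₁, ∀ q : Rn n × Rn n, ‖q‖ ≤ R → ‖F (t, q)‖ ≤ C := by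
  have hK : IsCompact (Icc t₀ t₁ ×ˢ Metric.closedBall (0 : Rn n × Rn n) R) :=
    isCompact_Icc.prod (isCompact_closedBall _ _)
  obtain ⟨C, hC⟩ := hK.exists_bound_of_continuousOn
    (hF.mono (prod_mono hI (subset_univ _)))
  exact ⟨C, fun t ht q hq => hC (t, q) ⟨ht, by simpa using hq⟩⟩

lemma continuousOn_comp_curve {n : ℕ} {V : Type*} [NormedAddCommGroup V] {T s : Set ℝ}
    (hs : s ⊆ T) {F : ℝ × Rn n × Rn n → V} (hF : ContinuousOn F (T ×ˢ univ))
    {γ : ℝ → Rn n × Rn n} (hγ : ContinuousOn γ s) : ContinuousOn (fun t => F (t, γ t)) s :=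
  hF.comp (continuousOn_id.prodMk hγ) fun _ ht => ⟨hs ht, trivial⟩

lemma integrableOn_comp_curve {n : ℕ} {T : Set ℝ} {t₀ t₁ : ℝ}
    (hI : Icc t₀ t₁ ⊆ T) {F : ℝ × Rn n × Rn n → ℝ} (hF : ContinuousOn F (T ×ˢ univ))
    {γ : ℝ → Rn n × Rn n} {S : Finset ℝ} (hγ : ContinuousOn γ (Icc t₀ t₁ \ (S : Set ℝ)))
    {R : ℝ} (hR : ∀ t ∈ Icc t₀ t₁, ‖γ t‖ ≤ R) :
    IntegrableOn (fun t => F (t, γ t)) (Icc t₀ t₁) := by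
  obtain ⟨C, hC⟩ := exists_bound_comp hI hF R
  refine IntegrableOn.of_bound (C := C) (by simp)
    (aestronglyMeasurable_of_continuousOn_diff S
      (continuousOn_comp_curve (sdiff_subset.trans hI) hF hγ)) ?_
  filter_upwards [ae_restrict_mem measurableSet_Icc] with t ht using hC t ht _ (hR t ht)

/-- Differentiation under the integral sign. For `|τ| < 1` the curves `γ + τ • ζ` stay in the ball
of radius `R + R'`, where `fderiv ℝ F` is bounded by compactness, so a constant dominates the
derivative. -/
lemma hasDerivAt_integral_line {n : ℕ} {T : Set ℝ} (hT : IsOpen T) {t₀ t₁ : ℝ} (ht : t₀ ≤ t₁)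
    (hI : Icc t₀ t₁ ⊆ T) {F : ℝ × Rn n × Rn n → ℝ} (hF : ContDiffOn ℝ 1 F (T ×ˢ univ))
    {γ ζ : ℝ → Rn n × Rn n} {S : Finset ℝ} (hγ : ContinuousOn γ (Icc t₀ t₁ \ (S : Set ℝ)))
    (hζ : ContinuousOn ζ (Icc t₀ t₁ \ (S : Set ℝ)))
    {R R' : ℝ} (hR : ∀ t ∈ Icc t₀ t₁, ‖γ t‖ ≤ R) (hR' : ∀ t ∈ Icc t₀ t₁, ‖ζ t‖ ≤ R') :
    IntervalIntegrable (fun t => fderiv ℝ F (t, γ t) (0, ζ t)) volume t₀ t₁ ∧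
    HasDerivAt (fun τ : ℝ => ∫ t in t₀..t₁, F (t, γ t + τ • ζ t))
      (∫ t in t₀..t₁, fderiv ℝ F (t, γ t) (0, ζ t)) 0 := by
  have hU : IsOpen (T ×ˢ (univ : Set (Rn n × Rn n))) := hT.prod isOpen_univ
  have hF' : ContinuousOn (fderiv ℝ F) (T ×ˢ univ) :=
    hF.continuousOn_fderiv_of_isOpen hU le_rfl
  obtain ⟨C, hC⟩ := exists_bound_comp hI hF' (R + R')
  have hline : ∀ τ : ℝ, ContinuousOn (fun t => γ t + τ • ζ t) (Icc t₀ t₁ \ (S : Set ℝ)) :=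
    fun τ => hγ.add (hζ.const_smul τ)
  have huIoc : uIoc t₀ t₁ ⊆ Icc t₀ t₁ := by
    rw [uIoc_of_le ht]; exact Ioc_subset_Icc_self
  have hbd : ∀ τ ∈ Metric.ball (0 : ℝ) 1, ∀ t ∈ Icc t₀ t₁, ‖γ t + τ • ζ t‖ ≤ R + R' := by
    intro τ hτ t h
    refine (norm_add_le _ _).trans (add_le_add (hR t h) ?_)
    rw [norm_smul]
    have h1 : ‖τ‖ ≤ 1 := by simpa using (Metric.ball_subset_closedBall hτ)
    exact (mul_le_of_le_one_left (norm_nonneg _) h1).trans (hR' t h)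
  have key := intervalIntegral.hasDerivAt_integral_of_dominated_loc_of_deriv_le
    (μ := volume) (a := t₀) (b := t₁) (x₀ := (0 : ℝ)) (s := Metric.ball (0 : ℝ) 1)
    (F := fun τ t => F (t, γ t + τ • ζ t))
    (F' := fun τ t => fderiv ℝ F (t, γ t + τ • ζ t) (0, ζ t)) (bound := fun _ => C * R')
    (Metric.ball_mem_nhds _ one_pos) ?_ ?_ ?_ ?_ ?_ ?_
  · simpa using key
  · refine Eventually.of_forall fun τ => ?_
    exact (aestronglyMeasurable_of_continuousOn_diff S (continuousOn_comp_curve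
      (sdiff_subset.trans hI) hF.continuousOn (hline τ))).mono_measure
      (Measure.restrict_mono huIoc le_rfl)
  · rw [intervalIntegrable_iff_integrableOn_Icc_of_le ht]
    exact integrableOn_comp_curve hI hF.continuousOn (hline 0) (hbd 0 (by simp))
  · refine (aestronglyMeasurable_of_continuousOn_diff S ?_).mono_measure
      (Measure.restrict_mono huIoc le_rfl)
    exact (continuousOn_comp_curve (sdiff_subset.trans hI) hF' (hline 0)).clm_apply
      (continuousOn_const.prodMk hζ)
  · refine Eventually.of_forall fun t h τ hτ => ?_
    have h' := huIoc h
    refine (ContinuousLinearMap.le_opNorm _ _).trans ?_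
    have h1 : ‖((0 : ℝ), ζ t)‖ ≤ R' := by
      simpa [Prod.norm_def] using hR' t h'
    have h2 := hC t h' _ (hbd τ hτ t h')
    exact mul_le_mul h2 h1 (norm_nonneg _) ((norm_nonneg _).trans h2)
  · simp
  · refine Eventually.of_forall fun t h τ hτ => ?_
    have h' := huIoc h
    have h1 : DifferentiableAt ℝ F (t, γ t + τ • ζ t) :=
      (hF.differentiableOn one_ne_zero).differentiableAt (hU.mem_nhds ⟨hI h', trivial⟩)
    have h2 : HasDerivAt (fun τ : ℝ => (t, γ t + τ • ζ t)) ((0 : ℝ), ζ t) τ := by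
      refine (hasDerivAt_const τ t).prodMk ?_
      simpa using ((hasDerivAt_id τ).smul_const (ζ t)).const_add (γ t)
    exact h1.hasFDerivAt.comp_hasDerivAt τ h2

/-- `L(t, x̄+z, ẋ̄+k) - L(t, x̄, ẋ̄) - L_xᵀ z - L_ẋᵀ k`, with `ẋ̄` taken along `s`. -/
def excess {n : ℕ} (L : ℝ → Rn n → Rn n → ℝ) (xb : ℝ → Rn n) (s : Set ℝ) (t : ℝ)
    (z k : Rn n) : ℝ :=
  L t (xb t + z) (derivWithin xb s t + k) - L t (xb t) (derivWithin xb s t)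
    - (Lx L t (xb t) (derivWithin xb s t) z + Ly L t (xb t) (derivWithin xb s t) k)

lemma ae_not_mem_finset (S : Finset ℝ) : ∀ᵐ t : ℝ, t ∉ S := by
  have := compl_mem_ae_iff.2 (S.finite_toSet.measure_zero volume)
  filter_upwards [this] with t ht using by simpa using ht

/-- The function `τ ↦ J(xb + τ z)` has a local minimum at the interior point `0` of `[-1, 1]`, so
the linear terms subtracted in `excess` integrate to zero. What remains is the increment of `J` at
`τ = 1`. -/
lemma integral_excess_nonneg {n : ℕ} {T : Set ℝ} (hT : IsOpen T) {t₀ t₁ : ℝ} (ht : t₀ < t₁)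
    (hI : Icc t₀ t₁ ⊆ T) {L : ℝ → Rn n → Rn n → ℝ}
    (hL : ContDiffOn ℝ 1 (uncurried L) (T ×ˢ univ)) {x₀ x₁ : Rn n} {xb z : ℝ → Rn n}
    (hxb : Admissible t₀ t₁ x₀ x₁ xb) {δ : ℝ}
    (hmin : ∀ x : ℝ → Rn n, Admissible t₀ t₁ x₀ x₁ x →
      (∀ t ∈ Icc t₀ t₁, ‖x t - xb t‖ ≤ δ) →
      eLpNorm (fun t => derivWithin x (Icc t₀ t₁) t - derivWithin xb (Icc t₀ t₁) t) ⊤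
        (volume.restrict (Icc t₀ t₁)) ≤ ENNReal.ofReal δ →
      J L t₀ t₁ xb ≤ J L t₀ t₁ x)
    (hz : PiecewiseSmooth t₀ t₁ z) (hz0 : z t₀ = 0) (hz1 : z t₁ = 0)
    (hzδ : ∀ t ∈ Icc t₀ t₁, ‖z t‖ ≤ δ)
    (hkδ : ∀ᵐ t, t ∈ Icc t₀ t₁ → ‖derivWithin z (Icc t₀ t₁) t‖ ≤ δ) :
    IntervalIntegrable (fun t => excess L xb (Icc t₀ t₁) t (z t)
      (derivWithin z (Icc t₀ t₁) t)) volume t₀ t₁ ∧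
    0 ≤ ∫ t in t₀..t₁, excess L xb (Icc t₀ t₁) t (z t) (derivWithin z (Icc t₀ t₁) t) := by
  have hU : IsOpen (T ×ˢ (univ : Set (Rn n × Rn n))) := hT.prod isOpen_univ
  obtain ⟨hxp, hxb0, hxb1⟩ := hxb
  obtain ⟨Cx, hCx⟩ := hxp.exists_bound_derivWithin
  obtain ⟨Cz, hCz⟩ := hz.exists_bound_derivWithin
  obtain ⟨Bx, hBx⟩ := isCompact_Icc.exists_bound_of_continuousOn hxp.1
  have hxp' := hxp
  have hz' := hz
  obtain ⟨hxc, S, hS, hxd, hxc', -⟩ := hxp'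
  obtain ⟨hzc, S', hS', hzd, hzc', -⟩ := hz'
  set I := Icc t₀ t₁ with hIdef
  set y := derivWithin xb I with hy
  set k := derivWithin z I with hk
  have sub1 : I \ ((S ∪ S' : Finset ℝ) : Set ℝ) ⊆ I \ (S : Set ℝ) :=
    sdiff_subset_sdiff_right (by simp)
  have sub2 : I \ ((S ∪ S' : Finset ℝ) : Set ℝ) ⊆ I \ (S' : Set ℝ) :=
    sdiff_subset_sdiff_right (by simp)
  have hγ : ContinuousOn (fun t => (xb t, y t)) (I \ ((S ∪ S' : Finset ℝ) : Set ℝ)) :=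
    (hxc.mono sdiff_subset).prodMk (hxc'.mono sub1)
  have hζ : ContinuousOn (fun t => (z t, k t)) (I \ ((S ∪ S' : Finset ℝ) : Set ℝ)) :=
    (hzc.mono sdiff_subset).prodMk (hzc'.mono sub2)
  have hR : ∀ t ∈ I, ‖(xb t, y t)‖ ≤ max Bx Cx := fun t h =>
    max_le_max (hBx t h) (hCx t h)
  have hR' : ∀ t ∈ I, ‖(z t, k t)‖ ≤ max δ Cz := fun t h =>
    max_le_max (hzδ t h) (hCz t h)
  obtain ⟨hint, hder⟩ := hasDerivAt_integral_line hT ht.le hI hL hγ hζ hR hR'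
  have hvint : ∀ τ : ℝ, IntervalIntegrable
      (fun t => uncurried L (t, (xb t, y t) + τ • (z t, k t))) volume t₀ t₁ := by
    intro τ
    rw [intervalIntegrable_iff_integrableOn_Icc_of_le ht.le]
    refine integrableOn_comp_curve hI hL.continuousOn (hγ.add (hζ.const_smul τ))
      (R := max Bx Cx + |τ| * max δ Cz) fun t h => (norm_add_le _ _).trans ?_
    refine add_le_add (hR t h) ?_
    rw [norm_smul]
    exact mul_le_mul_of_nonneg_left (hR' t h) (abs_nonneg τ)
  -- Additivity of the derivative may fail at break points, which form a null set.
  have hae : ∀ τ : ℝ, ∀ᵐ t, t ∈ I →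
      derivWithin (fun t => xb t + τ • z t) I t = y t + τ • k t := by
    intro τ
    filter_upwards [ae_not_mem_finset (S ∪ S')] with t h hti
    have h' : t ∉ S ∧ t ∉ S' := by simpa using h
    have d1 := hxd t ⟨hti, by simpa using h'.1⟩
    have d2 := hzd t ⟨hti, by simpa using h'.2⟩
    exact (d1.hasDerivWithinAt.add (d2.hasDerivWithinAt.const_smul τ)).derivWithin
      (uniqueDiffOn_Icc ht t hti)
  have hJ : ∀ τ : ℝ, J L t₀ t₁ (fun t => xb t + τ • z t)
      = ∫ t in t₀..t₁, uncurried L (t, (xb t, y t) + τ • (z t, k t)) := by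
    intro τ
    refine intervalIntegral.integral_congr_ae ?_
    filter_upwards [hae τ] with t h hti
    rw [uIoc_of_le ht.le] at hti
    rw [h (Ioc_subset_Icc_self hti)]
    rfl
  have hJ0 : J L t₀ t₁ xb = ∫ t in t₀..t₁, uncurried L (t, (xb t, y t)) := rfl
  have hle : ∀ τ : ℝ, |τ| ≤ 1 → J L t₀ t₁ xb ≤ J L t₀ t₁ (fun t => xb t + τ • z t) := by
    intro τ hτ
    refine hmin _ ⟨hxp.add (hz.const_smul τ), by simp [hxb0, hz0], by simp [hxb1, hz1]⟩ ?_ ?_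
    · intro t h
      rw [add_sub_cancel_left, norm_smul]
      exact (mul_le_of_le_one_left (norm_nonneg _) hτ).trans (hzδ t h)
    · refine (eLpNorm_le_of_ae_bound (C := δ) ?_).trans (by simp)
      rw [ae_restrict_iff' measurableSet_Icc]
      filter_upwards [hae τ, hkδ] with t h1 h2 hti
      rw [h1 hti, add_sub_cancel_left, norm_smul]
      exact (mul_le_of_le_one_left (norm_nonneg _) hτ).trans (h2 hti)
  have hlocmin : IsLocalMin
      (fun τ : ℝ => ∫ t in t₀..t₁, uncurried L (t, (xb t, y t) + τ • (z t, k t))) 0 := by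
    filter_upwards [Metric.closedBall_mem_nhds (0 : ℝ) one_pos] with τ hτ
    rw [← hJ τ]
    simpa [hJ0] using hle τ (by simpa using hτ)
  have hzero := hlocmin.hasDerivAt_eq_zero hder
  have hfd : ∀ t ∈ I, fderiv ℝ (uncurried L) (t, (xb t, y t)) (0, (z t, k t))
      = Lx L t (xb t) (y t) (z t) + Ly L t (xb t) (y t) (k t) := fun t h =>
    fderiv_apply_eq ((hL.differentiableOn one_ne_zero).differentiableAt
      (hU.mem_nhds ⟨hI h, trivial⟩)) _ _
  have hv0 := hvint 0
  have hv1 := hvint 1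
  simp only [zero_smul, add_zero, one_smul] at hv0 hv1
  have heq : EqOn (fun t => uncurried L (t, (xb t, y t) + (z t, k t))
      - uncurried L (t, (xb t, y t)) - fderiv ℝ (uncurried L) (t, (xb t, y t)) (0, (z t, k t)))
      (fun t => excess L xb I t (z t) (k t)) I := fun t h => by
    simp only [hfd t h]; rfl
  constructor
  · refine ((hv1.sub hv0).sub hint).congr_ae ?_
    rw [uIoc_of_le ht.le]
    filter_upwards [ae_restrict_mem measurableSet_Ioc] with t hti
    exact heq (Ioc_subset_Icc_self hti)
  · rw [← intervalIntegral.integral_congr (a := t₀) (b := t₁)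
      (by rw [uIcc_of_le ht.le]; exact heq), intervalIntegral.integral_sub (hv1.sub hv0) hint,
      intervalIntegral.integral_sub hv1 hv0, hzero, sub_zero, sub_nonneg]
    have := hle 1 (by simp)
    rw [hJ 1] at this
    simpa [hJ0] using this

/-! ### The triangular variation -/

/-- The function supported in `[a,c]` with slope `u` on `[a,b]` and slope `v` on `[b,c]`
(when `(b-a)u + (c-b)v = 0`). -/
def tent {n : ℕ} (a b c : ℝ) (u v : Rn n) (t : ℝ) : Rn n :=
  ramp a u t + ramp b (v - u) t + ramp c (-v) t

lemma tent_of_le {n : ℕ} {a b c t : ℝ} (hab : a < b) (hbc : b < c) (u v : Rn n) (h : t ≤ a) :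
    tent a b c u v t = 0 := by
  rw [tent, ramp_of_le _ h, ramp_of_le _ (by linarith), ramp_of_le _ (by linarith)]; simp

lemma tent_left {n : ℕ} {a b c t : ℝ} (hbc : b < c) (u v : Rn n) (h : a ≤ t)
    (h' : t ≤ b) : tent a b c u v t = (t - a) • u := by
  rw [tent, ramp_of_ge _ h, ramp_of_le _ (by linarith), ramp_of_le _ (by linarith)]; simp

lemma tent_right {n : ℕ} {a b c t : ℝ} (hab : a < b) {u v : Rn n}
    (huv : (b - a) • u + (c - b) • v = 0) (h : b ≤ t) (h' : t ≤ c) :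
    tent a b c u v t = (t - c) • v := by
  -- The difference of the two sides is exactly the closing condition `huv`, substituted here for
  -- zero.
  rw [tent, ramp_of_ge _ (by linarith), ramp_of_ge _ h, ramp_of_le _ h', add_zero, ← sub_eq_zero, ← huv]
  module

lemma tent_of_ge {n : ℕ} {a b c t : ℝ} (hab : a < b) (hbc : b < c) {u v : Rn n}
    (huv : (b - a) • u + (c - b) • v = 0) (h : c ≤ t) : tent a b c u v t = 0 := by
  rw [tent, ramp_of_ge _ (by linarith), ramp_of_ge _ (by linarith), ramp_of_ge _ h, ← huv]
  module

lemma hasDerivAt_tent {n : ℕ} {a b c t : ℝ} {u v : Rn n} {p q r : Rn n}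
    (h1 : HasDerivAt (ramp a u) p t) (h2 : HasDerivAt (ramp b (v - u)) q t)
    (h3 : HasDerivAt (ramp c (-v)) r t) : HasDerivAt (tent a b c u v) (p + q + r) t :=
  (h1.add h2).add h3

lemma integral_congr_Ioo {a b : ℝ} (h : a ≤ b) {f g : ℝ → ℝ} (hfg : EqOn f g (Ioo a b)) :
    ∫ t in a..b, f t = ∫ t in a..b, g t := by
  refine intervalIntegral.integral_congr_ae ?_
  rw [uIoc_of_le h]
  filter_upwards [ae_not_mem_finset {b}] with t ht hti
  exact hfg ⟨hti.1, lt_of_le_of_ne hti.2 (by simpa using ht)⟩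

/-- Outside `[a, c]` the tent and its slope vanish, hence so does the excess. The assumption `c - a
≤ 1` turns the slope bound `δ` into a bound on the tent itself. -/
lemma integral_excess_tent_nonneg {n : ℕ} {T : Set ℝ} (hT : IsOpen T) {t₀ t₁ : ℝ} (ht : t₀ < t₁)
    (hI : Icc t₀ t₁ ⊆ T) {L : ℝ → Rn n → Rn n → ℝ}
    (hL : ContDiffOn ℝ 1 (uncurried L) (T ×ˢ univ)) {x₀ x₁ : Rn n} {xb : ℝ → Rn n}
    (hxb : Admissible t₀ t₁ x₀ x₁ xb) {δ : ℝ} (hδ : 0 < δ)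
    (hmin : ∀ x : ℝ → Rn n, Admissible t₀ t₁ x₀ x₁ x →
      (∀ t ∈ Icc t₀ t₁, ‖x t - xb t‖ ≤ δ) →
      eLpNorm (fun t => derivWithin x (Icc t₀ t₁) t - derivWithin xb (Icc t₀ t₁) t) ⊤
        (volume.restrict (Icc t₀ t₁)) ≤ ENNReal.ofReal δ →
      J L t₀ t₁ xb ≤ J L t₀ t₁ x)
    {a b c : ℝ} (ha : t₀ ≤ a) (hab : a < b) (hbc : b < c) (hc : c ≤ t₁) (hac : c - a ≤ 1)
    {u v : Rn n} (huv : (b - a) • u + (c - b) • v = 0) (hu : ‖u‖ ≤ δ) (hv : ‖v‖ ≤ δ) :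
    0 ≤ (∫ t in a..b, excess L xb (Icc t₀ t₁) t ((t - a) • u) u)
      + ∫ t in b..c, excess L xb (Icc t₀ t₁) t ((t - c) • v) v := by
  have hz : PiecewiseSmooth t₀ t₁ (tent a b c u v) :=
    ((piecewiseSmooth_ramp ht a u).add (piecewiseSmooth_ramp ht b (v - u))).add
      (piecewiseSmooth_ramp ht c (-v))
  have key : ∀ {t : ℝ} {k : Rn n}, t ∈ Icc t₀ t₁ → HasDerivAt (tent a b c u v) k t →
      derivWithin (tent a b c u v) (Icc t₀ t₁) t = k := fun h h' =>
    h'.hasDerivWithinAt.derivWithin (uniqueDiffOn_Icc ht _ h)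
  have k0 : ∀ t ∈ Icc t₀ t₁, t < a → derivWithin (tent a b c u v) (Icc t₀ t₁) t = 0 :=
    fun t h h' => (key h (hasDerivAt_tent (hasDerivAt_ramp_of_lt _ h')
      (hasDerivAt_ramp_of_lt _ (by linarith)) (hasDerivAt_ramp_of_lt _ (by linarith)))).trans
      (by simp)
  have k1 : ∀ t ∈ Icc t₀ t₁, a < t → t < b →
      derivWithin (tent a b c u v) (Icc t₀ t₁) t = u :=
    fun t h h' h'' => (key h (hasDerivAt_tent (hasDerivAt_ramp_of_gt _ h')
      (hasDerivAt_ramp_of_lt _ h'') (hasDerivAt_ramp_of_lt _ (by linarith)))).trans (by simp)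
  have k2 : ∀ t ∈ Icc t₀ t₁, b < t → t < c →
      derivWithin (tent a b c u v) (Icc t₀ t₁) t = v :=
    fun t h h' h'' => (key h (hasDerivAt_tent (hasDerivAt_ramp_of_gt _ (by linarith))
      (hasDerivAt_ramp_of_gt _ h') (hasDerivAt_ramp_of_lt _ h''))).trans (by simp)
  have k3 : ∀ t ∈ Icc t₀ t₁, c < t → derivWithin (tent a b c u v) (Icc t₀ t₁) t = 0 :=
    fun t h h' => (key h (hasDerivAt_tent (hasDerivAt_ramp_of_gt _ (by linarith))
      (hasDerivAt_ramp_of_gt _ (by linarith)) (hasDerivAt_ramp_of_gt _ h'))).trans (by simp)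
  have bound : ∀ (r : ℝ) (w : Rn n), |r| ≤ 1 → ‖w‖ ≤ δ → ‖r • w‖ ≤ δ := fun r w hr hw => by
    rw [norm_smul]
    exact (mul_le_of_le_one_left (norm_nonneg _) hr).trans hw
  have hzδ : ∀ t ∈ Icc t₀ t₁, ‖tent a b c u v t‖ ≤ δ := by
    intro t _
    rcases le_total t a with h | h
    · rw [tent_of_le hab hbc u v h]; simpa using hδ.le
    rcases le_total t b with h' | h'
    · rw [tent_left hbc u v h h']
      exact bound _ _ (abs_le.2 ⟨by linarith, by linarith⟩) hu
    rcases le_total t c with h'' | h''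
    · rw [tent_right hab huv h' h'']
      exact bound _ _ (abs_le.2 ⟨by linarith, by linarith⟩) hv
    · rw [tent_of_ge hab hbc huv h'']; simpa using hδ.le
  have hkδ : ∀ᵐ t, t ∈ Icc t₀ t₁ → ‖derivWithin (tent a b c u v) (Icc t₀ t₁) t‖ ≤ δ := by
    filter_upwards [ae_not_mem_finset {a, b, c}] with t h hti
    have h' : t ≠ a ∧ t ≠ b ∧ t ≠ c := by simpa using h
    rcases lt_or_gt_of_ne h'.1 with h1 | h1
    · rw [k0 t hti h1]; simpa using hδ.le
    rcases lt_or_gt_of_ne h'.2.1 with h2 | h2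
    · rwa [k1 t hti h1 h2]
    rcases lt_or_gt_of_ne h'.2.2 with h3 | h3
    · rwa [k2 t hti h2 h3]
    · rw [k3 t hti h3]; simpa using hδ.le
  obtain ⟨hint, hnn⟩ := integral_excess_nonneg hT ht hI hL hxb hmin hz
    (tent_of_le hab hbc u v ha) (tent_of_ge hab hbc huv hc) hzδ hkδ
  have hsub : ∀ {p q : ℝ}, t₀ ≤ p → p ≤ q → q ≤ t₁ →
      IntervalIntegrable (fun t => excess L xb (Icc t₀ t₁) t (tent a b c u v t)
        (derivWithin (tent a b c u v) (Icc t₀ t₁) t)) volume p q := by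
    intro p q hp hpq hq
    refine hint.mono_set ?_
    rw [uIcc_of_le hpq, uIcc_of_le ht.le]
    exact Icc_subset_Icc hp hq
  rw [← intervalIntegral.integral_add_adjacent_intervals
      (hsub le_rfl ha (by linarith)) (hsub ha (by linarith : a ≤ t₁) le_rfl),
    ← intervalIntegral.integral_add_adjacent_intervals
      (hsub ha hab.le (by linarith)) (hsub (by linarith) (by linarith : b ≤ t₁) le_rfl),
    ← intervalIntegral.integral_add_adjacent_intervals
      (hsub (by linarith) hbc.le hc) (hsub (by linarith) hc le_rfl),
    integral_congr_Ioo ha (g := fun _ => 0) (fun t h => by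
      have e := k0 t ⟨h.1.le, by linarith [h.2]⟩ h.2
      simp only [e, tent_of_le hab hbc u v h.2.le]
      simp [excess]),
    integral_congr_Ioo hc (g := fun _ => 0) (fun t h => by
      have e := k3 t ⟨by linarith [h.1], h.2.le⟩ h.1
      simp only [e, tent_of_ge hab hbc huv h.1.le]
      simp [excess]),
    integral_congr_Ioo hab.le (g := fun t => excess L xb (Icc t₀ t₁) t ((t - a) • u) u)
      (fun t h => by
        have e := k1 t ⟨by linarith [h.1], by linarith [h.2]⟩ h.1 h.2
        simp only [e, tent_left hbc u v h.1.le h.2.le]),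
    integral_congr_Ioo hbc.le (g := fun t => excess L xb (Icc t₀ t₁) t ((t - c) • v) v)
      (fun t h => by
        have e := k2 t ⟨by linarith [h.1], by linarith [h.2]⟩ h.1 h.2
        simp only [e, tent_right hab huv h.1.le h.2.le])] at hnn
  simpa using hnn

/-! ### Second order expansions of Peano type -/

/-- `f` is differentiable along `s` near `θ`, and its derivative is differentiable at `θ`. -/
def TwiceDiffNear {V : Type*} [NormedAddCommGroup V] [NormedSpace ℝ V] (f : ℝ → V) (s : Set ℝ)
    (θ : ℝ) : Prop :=
  (∀ᶠ t in 𝓝[s] θ, DifferentiableWithinAt ℝ f s t) ∧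
    DifferentiableWithinAt ℝ (derivWithin f s) s θ

section TwiceDiffNear

variable {V V' : Type*} [NormedAddCommGroup V] [NormedSpace ℝ V]
  [NormedAddCommGroup V'] [NormedSpace ℝ V'] {s : Set ℝ} {θ : ℝ}

/-- Reduces second-order claims to an explicit formula for the first derivative near `θ`; the
closure properties below all use it. -/
lemma TwiceDiffNear.of_hasDerivWithinAt (hs : UniqueDiffOn ℝ s) (hθ : θ ∈ s) {f f' : ℝ → V}
    (h : ∀ᶠ t in 𝓝[s] θ, HasDerivWithinAt f (f' t) s t)
    (h' : DifferentiableWithinAt ℝ f' s θ) :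
    TwiceDiffNear f s θ ∧ derivWithin f s =ᶠ[𝓝[s] θ] f' := by
  have e : derivWithin f s =ᶠ[𝓝[s] θ] f' := by
    filter_upwards [h, self_mem_nhdsWithin] with t ht hts using ht.derivWithin (hs t hts)
  exact ⟨⟨h.mono fun t ht => ht.differentiableWithinAt,
    h'.congr_of_eventuallyEq e (e.self_of_nhdsWithin hθ)⟩, e⟩

lemma TwiceDiffNear.prodMk (hs : UniqueDiffOn ℝ s) (hθ : θ ∈ s) {f : ℝ → V} {g : ℝ → V'}
    (hf : TwiceDiffNear f s θ) (hg : TwiceDiffNear g s θ) :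
    TwiceDiffNear (fun t => (f t, g t)) s θ := by
  refine (TwiceDiffNear.of_hasDerivWithinAt hs hθ
    (f' := fun t => (derivWithin f s t, derivWithin g s t)) ?_ (hf.2.prodMk hg.2)).1
  filter_upwards [hf.1, hg.1] with t h1 h2
    using h1.hasDerivWithinAt.prodMk h2.hasDerivWithinAt

lemma TwiceDiffNear.comp (hs : UniqueDiffOn ℝ s) (hθ : θ ∈ s) {U : Set V} (hU : IsOpen U)
    {F : V → V'} (hF : ContDiffOn ℝ 2 F U) {γ : ℝ → V} (hγ : TwiceDiffNear γ s θ)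
    (hγU : γ θ ∈ U) : TwiceDiffNear (fun t => F (γ t)) s θ := by
  have hγθ : DifferentiableWithinAt ℝ γ s θ := hγ.1.self_of_nhdsWithin hθ
  have hev : ∀ᶠ t in 𝓝[s] θ, γ t ∈ U := hγθ.continuousWithinAt (hU.mem_nhds hγU)
  have hF' : DifferentiableAt ℝ (fderiv ℝ F) (γ θ) :=
    ((hF.fderiv_of_isOpen hU (m := 1) (by norm_num)).differentiableOn one_ne_zero).differentiableAt
      (hU.mem_nhds hγU)
  refine (TwiceDiffNear.of_hasDerivWithinAt hs hθ
    (f' := fun t => fderiv ℝ F (γ t) (derivWithin γ s t)) ?_ ?_).1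
  · filter_upwards [hγ.1, hev] with t h1 h2
    exact ((hF.differentiableOn two_ne_zero).differentiableAt
      (hU.mem_nhds h2)).hasFDerivAt.comp_hasDerivWithinAt t h1.hasDerivWithinAt
  · exact (hF'.comp_differentiableWithinAt θ hγθ).clm_apply hγ.2

lemma TwiceDiffNear.sub (hs : UniqueDiffOn ℝ s) (hθ : θ ∈ s) {f g : ℝ → V}
    (hf : TwiceDiffNear f s θ) (hg : TwiceDiffNear g s θ) :
    TwiceDiffNear (fun t => f t - g t) s θ := by
  refine (TwiceDiffNear.of_hasDerivWithinAt hs hθ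
    (f' := fun t => derivWithin f s t - derivWithin g s t) ?_ (hf.2.fun_sub hg.2)).1
  filter_upwards [hf.1, hg.1] with t h1 h2
    using h1.hasDerivWithinAt.fun_sub h2.hasDerivWithinAt

lemma TwiceDiffNear.derivWithin_lincomb (hs : UniqueDiffOn ℝ s) (hθ : θ ∈ s) {f g : ℝ → ℝ}
    (hf : TwiceDiffNear f s θ) (hg : TwiceDiffNear g s θ) (a b : ℝ) :
    derivWithin (fun t => a * f t + b * g t) s θ
        = a * derivWithin f s θ + b * derivWithin g s θ ∧
    derivWithin (derivWithin (fun t => a * f t + b * g t) s) s θ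
        = a * derivWithin (derivWithin f s) s θ + b * derivWithin (derivWithin g s) s θ := by
  have h' : HasDerivWithinAt (fun t => a * derivWithin f s t + b * derivWithin g s t)
      (a * derivWithin (derivWithin f s) s θ + b * derivWithin (derivWithin g s) s θ) s θ :=
    (hf.2.hasDerivWithinAt.const_mul a).fun_add (hg.2.hasDerivWithinAt.const_mul b)
  have h : derivWithin (fun t => a * f t + b * g t) s
      =ᶠ[𝓝[s] θ] fun t => a * derivWithin f s t + b * derivWithin g s t := by
    refine (TwiceDiffNear.of_hasDerivWithinAt hs hθ ?_ h'.differentiableWithinAt).2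
    filter_upwards [hf.1, hg.1] with t h1 h2
    exact (h1.hasDerivWithinAt.const_mul a).fun_add (h2.hasDerivWithinAt.const_mul b)
  exact ⟨h.self_of_nhdsWithin hθ,
    (h.derivWithin_eq (h.self_of_nhdsWithin hθ)).trans (h'.derivWithin (hs θ hθ))⟩

end TwiceDiffNear

lemma exists_forall_of_eventually_nhdsWithin {s : Set ℝ} {θ : ℝ} {p : ℝ → Prop}
    (h : ∀ᶠ t in 𝓝[s] θ, p t) : ∃ d > 0, ∀ t ∈ s, |t - θ| < d → p t := by
  obtain ⟨d, hd, h'⟩ := Metric.mem_nhdsWithin_iff.1 h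
  exact ⟨d, hd, fun t hts ht => h' ⟨by simpa [Real.dist_eq] using ht, hts⟩⟩

lemma mem_of_mem_uIcc {s : Set ℝ} (hs : s.OrdConnected) {a b t : ℝ} (ha : a ∈ s) (hb : b ∈ s)
    (ht : t ∈ uIcc a b) : t ∈ s := hs.uIcc_subset ha hb ht

lemma abs_sub_le_of_mem_uIcc {a b t : ℝ} (ht : t ∈ uIcc a b) : |t - a| ≤ |b - a| :=
  abs_sub_left_of_mem_uIcc ht

/-- The mean value inequality on a segment, with the bound at its far end. -/
lemma abs_sub_le_of_abs_deriv_le {f f' : ℝ → ℝ} {a b C : ℝ}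
    (hf : ∀ t ∈ uIcc a b, HasDerivWithinAt f (f' t) (uIcc a b) t)
    (hC : ∀ t ∈ uIcc a b, |f' t| ≤ C) : |f b - f a| ≤ C * |b - a| :=
  (convex_uIcc a b).norm_image_sub_le_of_norm_hasDerivWithin_le hf hC left_mem_uIcc right_mem_uIcc

/-- The derivative of `f` minus its quadratic Taylor polynomial is at most `κ |t - θ|` near `θ`,
because `derivWithin f s` is differentiable at `θ`. The mean value inequality on the segment from
`θ` to `t` adds the second factor. -/
lemma TwiceDiffNear.peano {f : ℝ → ℝ} {s : Set ℝ} {θ : ℝ} (hs : s.OrdConnected) (hθ : θ ∈ s)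
    (hf : TwiceDiffNear f s θ) {κ : ℝ} (hκ : 0 < κ) :
    ∃ d > 0, ∀ t ∈ s, |t - θ| < d →
      |f t - (f θ + derivWithin f s θ * (t - θ)
        + derivWithin (derivWithin f s) s θ / 2 * (t - θ) ^ 2)| ≤ κ * (t - θ) ^ 2 := by
  obtain ⟨d₁, hd₁, h₁⟩ := exists_forall_of_eventually_nhdsWithin hf.1
  obtain ⟨d₂, hd₂, h₂⟩ := exists_forall_of_eventually_nhdsWithin
    (hf.2.hasDerivWithinAt.hasFDerivWithinAt.isLittleO.def hκ)
  refine ⟨min d₁ d₂, lt_min hd₁ hd₂, fun t hts ht => ?_⟩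
  have key := abs_sub_le_of_abs_deriv_le (a := θ) (b := t) (C := κ * |t - θ|)
    (f := fun t => f t - (derivWithin f s θ * (t - θ)
        + derivWithin (derivWithin f s) s θ / 2 * (t - θ) ^ 2))
    (f' := fun t => derivWithin f s t - (derivWithin f s θ
        + derivWithin (derivWithin f s) s θ * (t - θ))) ?_ ?_
  · rw [mul_assoc, ← abs_mul, abs_mul_self, ← pow_two] at key
    convert key using 2
    ring
  · intro u hu
    have hus := mem_of_mem_uIcc hs hθ hts hu
    have hud : |u - θ| < d₁ := (abs_sub_le_of_mem_uIcc hu).trans_lt (ht.trans_le (min_le_left _ _))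
    have a1 := (h₁ u hus hud).hasDerivWithinAt.mono (hs.uIcc_subset hθ hts)
    have a2 : HasDerivAt (fun t : ℝ => derivWithin f s θ * (t - θ)
        + derivWithin (derivWithin f s) s θ / 2 * (t - θ) ^ 2)
        (derivWithin f s θ + derivWithin (derivWithin f s) s θ * (u - θ)) u := by
      have b : HasDerivAt (fun t : ℝ => t - θ) 1 u := (hasDerivAt_id u).sub_const θ
      exact ((b.const_mul (derivWithin f s θ)).fun_add
        ((b.fun_pow 2).const_mul (derivWithin (derivWithin f s) s θ / 2))).congr_deriv
        (by push_cast; ring)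
    exact a1.fun_sub a2.hasDerivWithinAt
  · intro u hu
    have hus := mem_of_mem_uIcc hs hθ hts hu
    have hud : |u - θ| < d₂ := (abs_sub_le_of_mem_uIcc hu).trans_lt (ht.trans_le (min_le_right _ _))
    have := h₂ u hus hud
    simp only [ContinuousLinearMap.toSpanSingleton_apply, smul_eq_mul, Real.norm_eq_abs] at this
    refine le_trans (le_of_eq ?_) (this.trans
      (mul_le_mul_of_nonneg_left (abs_sub_le_of_mem_uIcc hu) hκ.le))
    congr 1; ring

/-- Two applications of the mean value inequality. Comparing `g''` with a fixed `q`, rather than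
with `g'' 0`, allows the same quadratic coefficient for a whole family of functions `g`. -/
lemma abs_le_of_second_deriv {g g' g'' : ℝ → ℝ} {σ q κ : ℝ}
    (h1 : ∀ τ ∈ uIcc 0 σ, HasDerivAt g (g' τ) τ) (h2 : ∀ τ ∈ uIcc 0 σ, HasDerivAt g' (g'' τ) τ)
    (hq : ∀ τ ∈ uIcc 0 σ, |g'' τ - q| ≤ κ) :
    |g σ - g 0 - σ * g' 0 - σ ^ 2 / 2 * q| ≤ κ * σ ^ 2 := by
  have hκ : 0 ≤ κ := (abs_nonneg _).trans (hq 0 left_mem_uIcc)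
  have step : ∀ τ ∈ uIcc 0 σ, |g' τ - g' 0 - τ * q| ≤ κ * |σ| := by
    intro τ hτ
    have sub : uIcc 0 τ ⊆ uIcc 0 σ := uIcc_subset_uIcc left_mem_uIcc hτ
    have := abs_sub_le_of_abs_deriv_le (a := 0) (b := τ) (C := κ) (f := fun τ => g' τ - τ * q)
      (f' := fun τ => g'' τ - q)
      (fun u hu => ((h2 u (sub hu)).fun_sub
        (by simpa using (hasDerivAt_id u).mul_const q)).hasDerivWithinAt)
      (fun u hu => hq u (sub hu))
    have h3 := abs_sub_le_of_mem_uIcc hτ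
    calc |g' τ - g' 0 - τ * q| = |(g' τ - τ * q) - (g' 0 - 0 * q)| := by congr 1; ring
      _ ≤ κ * |τ - 0| := this
      _ ≤ κ * |σ| := mul_le_mul_of_nonneg_left (by simpa using h3) hκ
  have := abs_sub_le_of_abs_deriv_le (a := 0) (b := σ) (C := κ * |σ|)
    (f := fun τ => g τ - τ * g' 0 - τ ^ 2 / 2 * q)
    (f' := fun τ => g' τ - g' 0 - τ * q) ?_ step
  · rw [sub_zero, mul_assoc, ← abs_mul, abs_mul_self, ← pow_two] at this
    convert this using 2
    ring
  · intro u hu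
    have a1 : HasDerivAt (fun τ : ℝ => τ * g' 0) (g' 0) u := by
      simpa using (hasDerivAt_id u).mul_const (g' 0)
    have a2 : HasDerivAt (fun τ : ℝ => τ ^ 2 / 2 * q) (u * q) u := by
      exact ((((hasDerivAt_id' u).fun_pow 2).div_const 2).mul_const q).congr_deriv
        (by push_cast; ring)
    exact (((h1 u hu).fun_sub a1).fun_sub a2).hasDerivWithinAt

/-! ### Expansion of the excess along a triply differentiable function -/

/-- `x` is triply differentiable at `θ` along the interval `s`. -/
structure TriplyDiffAlong {n : ℕ} (xb : ℝ → Rn n) (s : Set ℝ) (θ : ℝ) : Prop where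
  ordConnected : s.OrdConnected
  uniqueDiffOn : UniqueDiffOn ℝ s
  mem : θ ∈ s
  twice : ∀ᶠ t in 𝓝[s] θ, TwiceDiffAt xb s t
  third : DifferentiableWithinAt ℝ (derivWithin (derivWithin xb s) s) s θ

/-! ### Regularity of the partial derivatives of the integrand. -/

section Integrand

variable {n : ℕ} {T : Set ℝ} {L : ℝ → Rn n → Rn n → ℝ}

lemma contDiffOn_Lx (hT : IsOpen T) (hL : SmoothIntegrand T L) :
    ContDiffOn ℝ 1 (fun p : ℝ × Rn n × Rn n => Lx L p.1 p.2.1 p.2.2) (T ×ˢ univ) := by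
  have hU : IsOpen (T ×ˢ (univ : Set (Rn n × Rn n))) := hT.prod isOpen_univ
  have h1 : ContDiffOn ℝ 1 (fun p => (fderiv ℝ (uncurried L) p).comp (inclX n)) (T ×ˢ univ) :=
    (ContDiffOn.fderiv_of_isOpen (f := uncurried L) hL.1 hU (m := 1) (by norm_num)).clm_comp
      contDiffOn_const
  exact h1.congr fun p hp => Lx_eq ((hL.1.differentiableOn two_ne_zero).differentiableAt
    (hU.mem_nhds hp))

lemma hasFDerivAt_Lx (hT : IsOpen T) (hL : SmoothIntegrand T L) {t : ℝ} (ht : t ∈ T)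
    (x y : Rn n) : HasFDerivAt (fun z => Lx L t z y) (Lxx L t x y) x := by
  have hU : IsOpen (T ×ˢ (univ : Set (Rn n × Rn n))) := hT.prod isOpen_univ
  exact (fderiv_comp_x (F := fun p : ℝ × Rn n × Rn n => Lx L p.1 p.2.1 p.2.2)
    (((contDiffOn_Lx hT hL).differentiableOn one_ne_zero).differentiableAt
    (hU.mem_nhds ⟨ht, trivial⟩))).differentiableAt.hasFDerivAt

lemma hasFDerivAt_L (hT : IsOpen T) (hL : SmoothIntegrand T L) {t : ℝ} (ht : t ∈ T)
    (x y : Rn n) : HasFDerivAt (fun z => L t z y) (Lx L t x y) x := by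
  have hU : IsOpen (T ×ˢ (univ : Set (Rn n × Rn n))) := hT.prod isOpen_univ
  exact (fderiv_comp_x (F := uncurried L) ((hL.1.differentiableOn two_ne_zero).differentiableAt
    (hU.mem_nhds ⟨ht, trivial⟩))).differentiableAt.hasFDerivAt

lemma continuousOn_Lxx (hT : IsOpen T) (hL : SmoothIntegrand T L) :
    ContinuousOn (fun p : ℝ × Rn n × Rn n => Lxx L p.1 p.2.1 p.2.2) (T ×ˢ univ) := by
  have hU : IsOpen (T ×ˢ (univ : Set (Rn n × Rn n))) := hT.prod isOpen_univ
  have h0 := contDiffOn_Lx hT hL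
  have h1 := (h0.continuousOn_fderiv_of_isOpen hU le_rfl).clm_comp
    (continuousOn_const (c := inclX n))
  refine h1.congr fun p hp => ?_
  exact (fderiv_comp_x (F := fun p : ℝ × Rn n × Rn n => Lx L p.1 p.2.1 p.2.2)
    ((h0.differentiableOn one_ne_zero).differentiableAt (hU.mem_nhds hp))).fderiv

end Integrand

section Expansion

variable {n : ℕ} {T s : Set ℝ} {L : ℝ → Rn n → Rn n → ℝ} {xb : ℝ → Rn n} {θ : ℝ}

lemma TriplyDiffAlong.twiceDiffNear (h : TriplyDiffAlong xb s θ) : TwiceDiffNear xb s θ :=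
  ⟨h.twice.mono fun _ h => h.1, (h.twice.self_of_nhdsWithin h.mem).2⟩

lemma TriplyDiffAlong.twiceDiffNear_derivWithin (h : TriplyDiffAlong xb s θ) :
    TwiceDiffNear (derivWithin xb s) s θ :=
  ⟨h.twice.mono fun _ h => h.2, h.third⟩

/-- The curve `t ↦ (t, x̄(t), ẋ̄(t) + u)`. -/
def shiftedCurve (xb : ℝ → Rn n) (s : Set ℝ) (u : Rn n) (t : ℝ) : ℝ × Rn n × Rn n :=
  (t, xb t, derivWithin xb s t + u)

lemma TriplyDiffAlong.twiceDiffNear_shiftedCurve (h : TriplyDiffAlong xb s θ) (u : Rn n) :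
    TwiceDiffNear (shiftedCurve xb s u) s θ := by
  have h0 : TwiceDiffNear (fun t : ℝ => t) s θ := by
    refine (TwiceDiffNear.of_hasDerivWithinAt h.uniqueDiffOn h.mem (f' := fun _ => 1)
      (Eventually.of_forall fun t => hasDerivWithinAt_id t s) ?_).1
    exact differentiableWithinAt_const _
  have h1 := TwiceDiffNear.comp h.uniqueDiffOn h.mem isOpen_univ
    (F := fun y : Rn n => y + u) (contDiff_id.add contDiff_const).contDiffOn
    h.twiceDiffNear_derivWithin trivial
  exact h0.prodMk h.uniqueDiffOn h.mem (h.twiceDiffNear.prodMk h.uniqueDiffOn h.mem h1)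

/-- `Eb` involves `L_ẋ` along the curve and two of its derivatives are taken, hence the `C²`
assumption on `L_ẋ`. The curve contains `ẋ̄`, hence the third derivative of `xb`. -/
lemma TriplyDiffAlong.twiceDiffNear_Eb (h : TriplyDiffAlong xb s θ) (hT : IsOpen T) (hθ : θ ∈ T)
    (hL : SmoothIntegrand T L) (u : Rn n) :
    TwiceDiffNear (fun t => Eb L xb s t u) s θ := by
  have hU : IsOpen (T ×ˢ (univ : Set (Rn n × Rn n))) := hT.prod isOpen_univ
  have h1 := TwiceDiffNear.comp h.uniqueDiffOn h.mem hU hL.1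
    (h.twiceDiffNear_shiftedCurve u) ⟨hθ, trivial⟩
  have h2 := TwiceDiffNear.comp h.uniqueDiffOn h.mem hU hL.1
    (h.twiceDiffNear_shiftedCurve 0) ⟨hθ, trivial⟩
  have h3 := TwiceDiffNear.comp h.uniqueDiffOn h.mem hU
    (hL.2.clm_apply (contDiffOn_const (c := u))) (h.twiceDiffNear_shiftedCurve 0) ⟨hθ, trivial⟩
  convert (h1.sub h.uniqueDiffOn h.mem h2).sub h.uniqueDiffOn h.mem h3 using 2 with t
  simp [Eb, weierstrass, shiftedCurve]

lemma TriplyDiffAlong.differentiableWithinAt_dLx (h : TriplyDiffAlong xb s θ) (hT : IsOpen T)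
    (hθ : θ ∈ T) (hL : SmoothIntegrand T L) (u v : Rn n) :
    DifferentiableWithinAt ℝ (fun t => dLx L xb s t u v) s θ := by
  have hU : IsOpen (T ×ˢ (univ : Set (Rn n × Rn n))) := hT.prod isOpen_univ
  have h0 : ∀ w : Rn n, DifferentiableWithinAt ℝ
      (fun t => Lx L t (xb t) (derivWithin xb s t + w)) s θ := fun w =>
    DifferentiableAt.comp_differentiableWithinAt θ (f := shiftedCurve xb s w)
      (g := fun p : ℝ × Rn n × Rn n => Lx L p.1 p.2.1 p.2.2)
      (((contDiffOn_Lx hT hL).differentiableOn one_ne_zero).differentiableAt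
        (hU.mem_nhds ⟨hθ, trivial⟩))
      ((h.twiceDiffNear_shiftedCurve w).1.self_of_nhdsWithin h.mem)
  have h1 := ((h0 u).fun_sub (h0 0)).clm_apply (differentiableWithinAt_const v)
  simpa [dLx] using h1

/-- The second order expansion of `excess L xb s t (σ • u) u` in `r = t - θ` and `σ`. -/
def excessModel (L : ℝ → Rn n → Rn n → ℝ) (xb : ℝ → Rn n) (s : Set ℝ) (θ : ℝ) (u : Rn n)
    (r σ : ℝ) : ℝ :=
  Eb L xb s θ u + derivWithin (fun t => Eb L xb s t u) s θ * r
    + derivWithin (derivWithin (fun t => Eb L xb s t u) s) s θ / 2 * r ^ 2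
    + σ * (dLx L xb s θ u u + derivWithin (fun t => dLx L xb s t u u) s θ * r)
    + σ ^ 2 / 2 * Lxxb L xb s θ u u u

/-- Moving first in the velocity and then in the position separates the dependence on `t` from that
on `σ`: only the last bracket is nonlinear in `σ`, and it is of second order. -/
lemma excess_eq (t σ : ℝ) (u : Rn n) :
    excess L xb s t (σ • u) u = Eb L xb s t u + σ * dLx L xb s t u u
      + (L t (xb t + σ • u) (derivWithin xb s t + u) - L t (xb t) (derivWithin xb s t + u)
        - σ * Lx L t (xb t) (derivWithin xb s t + u) u) := by
  simp only [excess, Eb, weierstrass, dLx, map_smul, smul_eq_mul, add_sub_cancel_left,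
    sub_apply]
  ring

/-- Joint continuity of `L_xx` at the limit point makes the estimate uniform in `t` near `θ`; the
coefficient can be frozen at `θ`. -/
lemma TriplyDiffAlong.expansion_x (h : TriplyDiffAlong xb s θ) (hT : IsOpen T)
    (hθ : θ ∈ T) (hL : SmoothIntegrand T L) (u : Rn n) {κ : ℝ} (hκ : 0 < κ) :
    ∃ d > 0, ∀ t ∈ s, |t - θ| < d → ∀ σ : ℝ, |σ| < d →
      |L t (xb t + σ • u) (derivWithin xb s t + u) - L t (xb t) (derivWithin xb s t + u)
        - σ * Lx L t (xb t) (derivWithin xb s t + u) u - σ ^ 2 / 2 * Lxxb L xb s θ u u u|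
        ≤ κ * σ ^ 2 := by
  have hU : IsOpen (T ×ˢ (univ : Set (Rn n × Rn n))) := hT.prod isOpen_univ
  have hxc : Tendsto xb (𝓝[s] θ) (𝓝 (xb θ)) :=
    (h.twice.self_of_nhdsWithin h.mem).1.continuousWithinAt
  have hyc : Tendsto (derivWithin xb s) (𝓝[s] θ) (𝓝 (derivWithin xb s θ)) :=
    (h.twice.self_of_nhdsWithin h.mem).2.continuousWithinAt
  have hfst : Tendsto (Prod.fst : ℝ × ℝ → ℝ) (𝓝[s] θ ×ˢ 𝓝 0) (𝓝[s] θ) := tendsto_fst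
  have hsnd : Tendsto (Prod.snd : ℝ × ℝ → ℝ) (𝓝[s] θ ×ˢ 𝓝 0) (𝓝 0) := tendsto_snd
  have hcurve : Tendsto (fun p : ℝ × ℝ => (p.1, xb p.1 + p.2 • u, derivWithin xb s p.1 + u))
      (𝓝[s] θ ×ˢ 𝓝 0) (𝓝 (θ, xb θ + (0 : ℝ) • u, derivWithin xb s θ + u)) :=
    (hfst.mono_right nhdsWithin_le_nhds).prodMk_nhds
      (((hxc.comp hfst).add (hsnd.smul_const u)).prodMk_nhds
        ((hyc.comp hfst).add_const u))
  have hc : ContinuousAt (fun p : ℝ × Rn n × Rn n => Lxx L p.1 p.2.1 p.2.2 u u)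
      (θ, xb θ + (0 : ℝ) • u, derivWithin xb s θ + u) :=
    (((continuousOn_Lxx hT hL).clm_apply continuousOn_const).clm_apply
      continuousOn_const).continuousAt (hU.mem_nhds ⟨hθ, trivial⟩)
  have hq : Lxx L θ (xb θ + (0 : ℝ) • u) (derivWithin xb s θ + u) u u = Lxxb L xb s θ u u u := by
    simp [Lxxb]
  have hlim := hc.tendsto.comp hcurve
  rw [hq] at hlim
  have hev := hlim.eventually (Metric.closedBall_mem_nhds _ hκ)
  obtain ⟨pa, ha, pb, hb, hab⟩ := eventually_prod_iff.1 hev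
  have haT : ∀ᶠ t in 𝓝[s] θ, t ∈ T := mem_nhdsWithin_of_mem_nhds (hT.mem_nhds hθ)
  obtain ⟨d₁, hd₁, h₁⟩ := exists_forall_of_eventually_nhdsWithin (ha.and haT)
  obtain ⟨d₂, hd₂, h₂⟩ := Metric.eventually_nhds_iff.1 hb
  refine ⟨min d₁ d₂, lt_min hd₁ hd₂, fun t hts ht σ hσ => ?_⟩
  obtain ⟨hpa, htT⟩ := h₁ t hts (ht.trans_le (min_le_left _ _))
  have hline : ∀ τ : ℝ, HasDerivAt (fun τ : ℝ => xb t + τ • u) u τ := fun τ => by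
    simpa using ((hasDerivAt_id τ).smul_const u).const_add (xb t)
  have key := abs_le_of_second_deriv (σ := σ) (κ := κ) (q := Lxxb L xb s θ u u u)
    (g := fun τ => L t (xb t + τ • u) (derivWithin xb s t + u))
    (g' := fun τ => Lx L t (xb t + τ • u) (derivWithin xb s t + u) u)
    (g'' := fun τ => Lxx L t (xb t + τ • u) (derivWithin xb s t + u) u u)
    (fun τ _ => (hasFDerivAt_L hT hL htT _ _).comp_hasDerivAt τ (hline τ))
    (fun τ _ => by
      simpa using ((hasFDerivAt_Lx hT hL htT _ _).comp_hasDerivAt τ (hline τ)).clm_apply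
        (hasDerivAt_const τ u))
    (fun τ hτ => by
      have h3 := abs_sub_le_of_mem_uIcc hτ
      have h4 : |τ| < d₂ := by
        simp only [sub_zero] at h3
        exact h3.trans_lt (hσ.trans_le (min_le_right _ _))
      simpa [Real.dist_eq] using hab hpa (h₂ (by simpa using h4)))
  simpa using key

/-- Since `dLx` is multiplied by `σ`, a first-order expansion suffices for it; `Eb` needs second
order. The three errors each take `κ / 3`. -/
lemma TriplyDiffAlong.expansion (h : TriplyDiffAlong xb s θ) (hT : IsOpen T)
    (hθ : θ ∈ T) (hL : SmoothIntegrand T L) (u : Rn n) {κ : ℝ} (hκ : 0 < κ) :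
    ∃ d > 0, ∀ ρ < d, ∀ t ∈ s, |t - θ| ≤ ρ → ∀ σ : ℝ, |σ| ≤ ρ →
      |excess L xb s t (σ • u) u - excessModel L xb s θ u (t - θ) σ| ≤ κ * ρ ^ 2 := by
  have hκ' : 0 < κ / 3 := by linarith
  obtain ⟨d₁, hd₁, h₁⟩ := (h.twiceDiffNear_Eb hT hθ hL u).peano h.ordConnected h.mem hκ'
  obtain ⟨d₂, hd₂, h₂⟩ := exists_forall_of_eventually_nhdsWithin
    ((h.differentiableWithinAt_dLx hT hθ hL u u).hasDerivWithinAt.hasFDerivWithinAt.isLittleO.def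
      hκ')
  obtain ⟨d₃, hd₃, h₃⟩ := h.expansion_x hT hθ hL u hκ'
  refine ⟨min d₁ (min d₂ d₃), lt_min hd₁ (lt_min hd₂ hd₃), fun ρ hρ t hts ht σ hσ => ?_⟩
  have hρ1 : ρ < d₁ := hρ.trans_le (min_le_left _ _)
  have hρ2 : ρ < d₂ := hρ.trans_le ((min_le_right _ _).trans (min_le_left _ _))
  have hρ3 : ρ < d₃ := hρ.trans_le ((min_le_right _ _).trans (min_le_right _ _))
  have k1 := h₁ t hts (ht.trans_lt hρ1)
  have k2 := h₂ t hts (ht.trans_lt hρ2)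
  have k3 := h₃ t hts (ht.trans_lt hρ3) σ (hσ.trans_lt hρ3)
  simp only [ContinuousLinearMap.toSpanSingleton_apply, smul_eq_mul, Real.norm_eq_abs] at k2
  have hρ0 : 0 ≤ ρ := (abs_nonneg _).trans ht
  have sq1 : (t - θ) ^ 2 ≤ ρ ^ 2 := sq_le_sq' (by linarith [(abs_le.1 ht).1]) (abs_le.1 ht).2
  have sq2 : σ ^ 2 ≤ ρ ^ 2 := sq_le_sq' (by linarith [(abs_le.1 hσ).1]) (abs_le.1 hσ).2
  rw [excess_eq, excessModel]
  set e := Eb L xb s t u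
  set m := dLx L xb s t u u
  set X := L t (xb t + σ • u) (derivWithin xb s t + u) - L t (xb t) (derivWithin xb s t + u)
        - σ * Lx L t (xb t) (derivWithin xb s t + u) u
  set e0 := Eb L xb s θ u
  set e1 := derivWithin (fun t => Eb L xb s t u) s θ
  set e2 := derivWithin (derivWithin (fun t => Eb L xb s t u) s) s θ
  set m0 := dLx L xb s θ u u
  set m1 := derivWithin (fun t => dLx L xb s t u u) s θ
  set q := Lxxb L xb s θ u u u
  have k2' : |σ * (m - m0 - (t - θ) * m1)| ≤ κ / 3 * ρ ^ 2 := by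
    rw [abs_mul]
    calc |σ| * |m - m0 - (t - θ) * m1| ≤ ρ * (κ / 3 * |t - θ|) :=
          mul_le_mul hσ k2 (abs_nonneg _) hρ0
      _ ≤ ρ * (κ / 3 * ρ) := by gcongr
      _ = κ / 3 * ρ ^ 2 := by ring
  have k1' : κ / 3 * (t - θ) ^ 2 ≤ κ / 3 * ρ ^ 2 := by gcongr
  have k3' : κ / 3 * σ ^ 2 ≤ κ / 3 * ρ ^ 2 := by gcongr
  calc _ = |(e - (e0 + e1 * (t - θ) + e2 / 2 * (t - θ) ^ 2))
            + σ * (m - m0 - (t - θ) * m1) + (X - σ ^ 2 / 2 * q)| := by congr 1; ring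
    _ ≤ _ := abs_add_three _ _ _
    _ ≤ κ * ρ ^ 2 := by linarith

lemma TriplyDiffAlong.continuousOn_excess (h : TriplyDiffAlong xb s θ) (hT : IsOpen T)
    (hsT : s ⊆ T) (hL : SmoothIntegrand T L) (u : Rn n) :
    ∃ d > 0, ∀ S ⊆ s, (∀ t ∈ S, |t - θ| < d) → ∀ σ : ℝ → ℝ, Continuous σ →
      ContinuousOn (fun t => excess L xb s t (σ t • u) u) S := by
  obtain ⟨d, hd, h'⟩ := exists_forall_of_eventually_nhdsWithin h.twice
  refine ⟨d, hd, fun S hS hSd σ hσ => ?_⟩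
  have hx : ContinuousOn xb S := fun t ht =>
    (h' t (hS ht) (hSd t ht)).1.continuousWithinAt.mono hS
  have hy : ContinuousOn (derivWithin xb s) S := fun t ht =>
    (h' t (hS ht) (hSd t ht)).2.continuousWithinAt.mono hS
  have hST : S ⊆ T := hS.trans hsT
  have hσ' : ContinuousOn (fun t => σ t • u) S := (hσ.smul continuous_const).continuousOn
  have c1 := continuousOn_comp_curve hST hL.1.continuousOn
    ((hx.add hσ').prodMk (hy.add (continuousOn_const (c := u))))
  have c2 := continuousOn_comp_curve hST hL.1.continuousOn (hx.prodMk hy)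
  have c3 := (continuousOn_comp_curve hST (contDiffOn_Lx hT hL).continuousOn
    (hx.prodMk hy)).clm_apply hσ'
  have c4 := (continuousOn_comp_curve hST hL.2.continuousOn
    (hx.prodMk hy)).clm_apply (continuousOn_const (c := u))
  exact (c1.sub c2).sub (c3.add c4)

/-- An antiderivative of `r ↦ excessModel L xb s θ u r (r - c)`. -/
def excessModelPrimitive (L : ℝ → Rn n → Rn n → ℝ) (xb : ℝ → Rn n) (s : Set ℝ) (θ : ℝ)
    (u : Rn n) (c r : ℝ) : ℝ :=
  Eb L xb s θ u * r + derivWithin (fun t => Eb L xb s t u) s θ / 2 * r ^ 2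
    + derivWithin (derivWithin (fun t => Eb L xb s t u) s) s θ / 6 * r ^ 3
    + dLx L xb s θ u u / 2 * (r - c) ^ 2
    + derivWithin (fun t => dLx L xb s t u u) s θ * (r ^ 3 / 3 - c / 2 * r ^ 2)
    + Lxxb L xb s θ u u u / 6 * (r - c) ^ 3

lemma hasDerivAt_excessModelPrimitive (u : Rn n) (c t : ℝ) :
    HasDerivAt (fun t => excessModelPrimitive L xb s θ u c (t - θ))
      (excessModel L xb s θ u (t - θ) (t - θ - c)) t := by
  have b : HasDerivAt (fun t : ℝ => t - θ) 1 t := (hasDerivAt_id t).sub_const θ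
  have b' : HasDerivAt (fun t : ℝ => t - θ - c) 1 t := b.sub_const c
  have key : ∀ e₀ e₁ e₂ m₀ m₁ q : ℝ, HasDerivAt
      (fun t => e₀ * (t - θ) + e₁ / 2 * (t - θ) ^ 2 + e₂ / 6 * (t - θ) ^ 3
        + m₀ / 2 * (t - θ - c) ^ 2 + m₁ * ((t - θ) ^ 3 / 3 - c / 2 * (t - θ) ^ 2)
        + q / 6 * (t - θ - c) ^ 3)
      (e₀ + e₁ * (t - θ) + e₂ / 2 * (t - θ) ^ 2 + (t - θ - c) * (m₀ + m₁ * (t - θ))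
        + (t - θ - c) ^ 2 / 2 * q) t := fun e₀ e₁ e₂ m₀ m₁ q =>
    ((((((b.const_mul e₀).fun_add ((b.fun_pow 2).const_mul (e₁ / 2))).fun_add
      ((b.fun_pow 3).const_mul (e₂ / 6))).fun_add ((b'.fun_pow 2).const_mul (m₀ / 2))).fun_add
      ((((b.fun_pow 3).div_const 3).fun_sub ((b.fun_pow 2).const_mul (c / 2))).const_mul
        m₁)).fun_add ((b'.fun_pow 3).const_mul (q / 6))).congr_deriv (by push_cast; ring)
  exact key _ _ _ _ _ _

lemma continuous_excessModel (u : Rn n) (c : ℝ) :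
    Continuous fun t => excessModel L xb s θ u (t - θ) (t - θ - c) := by
  unfold excessModel
  fun_prop

/-- On an affine piece of the tent `σ = t - θ - c`, where `θ + c` is the zero of that piece. The
model is then a polynomial with an explicit primitive. -/
lemma TriplyDiffAlong.integral_expansion (h : TriplyDiffAlong xb s θ) (hT : IsOpen T)
    (hsT : s ⊆ T) (hL : SmoothIntegrand T L) (u : Rn n) {κ : ℝ} (hκ : 0 < κ) :
    ∃ d > 0, ∀ ρ < d, ∀ p ∈ s, ∀ q ∈ s, ∀ c, |p - θ| ≤ ρ → |q - θ| ≤ ρ →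
      |p - θ - c| ≤ ρ → |q - θ - c| ≤ ρ →
      |(∫ t in p..q, excess L xb s t ((t - θ - c) • u) u)
        - (excessModelPrimitive L xb s θ u c (q - θ)
          - excessModelPrimitive L xb s θ u c (p - θ))| ≤ κ * ρ ^ 2 * |q - p| := by
  obtain ⟨d₁, hd₁, h₁⟩ := h.expansion hT (hsT h.mem) hL u hκ
  obtain ⟨d₂, hd₂, h₂⟩ := h.continuousOn_excess hT hsT hL u
  refine ⟨min d₁ d₂, lt_min hd₁ hd₂, fun ρ hρ p hp q hq c hpρ hqρ hpc hqc => ?_⟩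
  have hball : ∀ t ∈ uIcc p q, |t - θ| ≤ ρ ∧ |t - θ - c| ≤ ρ := by
    intro t ht
    rw [abs_le] at *
    rw [abs_le]
    rcases mem_uIcc.1 ht with ⟨a, b⟩ | ⟨a, b⟩ <;>
      exact ⟨⟨by linarith, by linarith⟩, by linarith, by linarith⟩
  have hsub : uIcc p q ⊆ s := h.ordConnected.uIcc_subset hp hq
  have hint : IntervalIntegrable (fun t => excess L xb s t ((t - θ - c) • u) u) volume p q :=
    (h₂ _ hsub (fun t ht => (hball t ht).1.trans_lt (hρ.trans_le (min_le_right _ _)))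
      (fun t => t - θ - c) (by fun_prop)).intervalIntegrable
  have hint' := (continuous_excessModel (L := L) (xb := xb) (s := s) (θ := θ) u
    c).intervalIntegrable (μ := volume) p q
  rw [← intervalIntegral.integral_eq_sub_of_hasDerivAt
    (fun t _ => hasDerivAt_excessModelPrimitive u c t) hint',
    ← intervalIntegral.integral_sub hint hint']
  refine intervalIntegral.norm_integral_le_of_norm_le_const (E := ℝ) fun t ht => ?_
  have ht' := uIoc_subset_uIcc ht
  exact h₁ ρ (hρ.trans_le (min_le_left _ _)) t (hsub ht') (hball t ht').1 _ (hball t ht').2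

end Expansion

/-! ### Expansion of the increment of the functional -/

section Increment

variable {n : ℕ} {T s : Set ℝ} {L : ℝ → Rn n → Rn n → ℝ} {xb : ℝ → Rn n} {θ : ℝ}

/-- The integral of the excess over the two pieces of the triangular variation. -/
def needleIntegral (L : ℝ → Rn n → Rn n → ℝ) (xb : ℝ → Rn n) (s : Set ℝ) (θ lam : ℝ) (η : Rn n)
    (ε : ℝ) : ℝ :=
  (∫ t in θ..θ + lam * ε, excess L xb s t ((t - θ) • η) η)
    + ∫ t in θ + lam * ε..θ + ε,
        excess L xb s t ((t - (θ + ε)) • (lam / (lam - 1)) • η) ((lam / (lam - 1)) • η)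

lemma TriplyDiffAlong.derivWithin_dLx_smul (h : TriplyDiffAlong xb s θ) (hT : IsOpen T)
    (hθ : θ ∈ T) (hL : SmoothIntegrand T L) (μ : ℝ) (u v : Rn n) :
    derivWithin (fun t => dLx L xb s t u (μ • v)) s θ
      = μ * derivWithin (fun t => dLx L xb s t u v) s θ := by
  simp only [map_smul, smul_eq_mul]
  exact derivWithin_const_mul _ (h.differentiableWithinAt_dLx hT hθ hL u v)

/-- The origin of `Q`, `M`, `W` and `G`: they collect the coefficients of `ε`, `ε²/2` and `ε³/6`.
The first piece vanishes at `r = 0` and the second at `r = ε`. The factor `1/2 + lam` in `M 2` comes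
from integrating `r (r - ε)` over `[lam ε, ε]`. -/
lemma TriplyDiffAlong.primitive_sum (h : TriplyDiffAlong xb s θ) (hT : IsOpen T)
    (hθ : θ ∈ T) (hL : SmoothIntegrand T L) (η : Rn n) {lam : ℝ} (hlam : lam < 1) (ε : ℝ) :
    excessModelPrimitive L xb s θ η 0 (lam * ε) - excessModelPrimitive L xb s θ η 0 0
      + (excessModelPrimitive L xb s θ ((lam / (lam - 1)) • η) ε ε
        - excessModelPrimitive L xb s θ ((lam / (lam - 1)) • η) ε (lam * ε))
      = ε * Q 1 L xb s θ lam η + ε ^ 2 / 2 * W L xb s θ lam η + ε ^ 3 / 6 * G L xb s θ lam η := by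
  have hE := h.twiceDiffNear_Eb hT hθ hL η
  have hE' := h.twiceDiffNear_Eb hT hθ hL ((lam / (lam - 1)) • η)
  have q2 : derivWithin (fun t => Q 2 L xb s t lam η) s θ = _ :=
    (hE.derivWithin_lincomb h.uniqueDiffOn h.mem hE' (lam ^ 2) (1 - lam ^ 2)).1
  have q3 : derivWithin (derivWithin (fun t => Q 3 L xb s t lam η) s) s θ = _ :=
    (hE.derivWithin_lincomb h.uniqueDiffOn h.mem hE' (lam ^ 3) (1 - lam ^ 3)).2
  have m2 : derivWithin (fun t => M 2 L xb s t lam η) s θ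
      = lam ^ 2 * derivWithin (fun t => dLx L xb s t η η) s θ
        + (1 - lam) * (1 / 2 + lam) ^ (2 - 1)
          * derivWithin (fun t => dLx L xb s t ((lam / (lam - 1)) • η) η) s θ :=
    (((h.differentiableWithinAt_dLx hT hθ hL η η).hasDerivWithinAt.const_mul _).fun_add
      ((h.differentiableWithinAt_dLx hT hθ hL _ η).hasDerivWithinAt.const_mul _)).derivWithin
      (h.uniqueDiffOn θ h.mem)
  rw [W, G, q2, q3, m2]
  simp only [excessModelPrimitive]
  rw [h.derivWithin_dLx_smul hT hθ hL]
  simp only [Q, M, map_smul, smul_apply, smul_eq_mul]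
  have h1 : lam - 1 ≠ 0 := by linarith
  field_simp
  ring

/-- Both signs of `ε` are allowed, so one expansion serves variations on either side of `θ`. The
pieces have lengths `lam |ε|` and `(1 - lam) |ε|`, so their errors add up to `κ |ε|³`. -/
lemma TriplyDiffAlong.needleIntegral_expansion (h : TriplyDiffAlong xb s θ) (hT : IsOpen T)
    (hsT : s ⊆ T) (hL : SmoothIntegrand T L) (η : Rn n) {lam : ℝ} (hlam : lam ∈ Ioo (0 : ℝ) 1)
    {κ : ℝ} (hκ : 0 < κ) :
    ∃ d > 0, ∀ ε, |ε| < d → θ + ε ∈ s →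
      |needleIntegral L xb s θ lam η ε
        - (ε * Q 1 L xb s θ lam η + ε ^ 2 / 2 * W L xb s θ lam η
          + ε ^ 3 / 6 * G L xb s θ lam η)| ≤ κ * |ε| ^ 3 := by
  obtain ⟨d₁, hd₁, h₁⟩ := h.integral_expansion hT hsT hL η hκ
  obtain ⟨d₂, hd₂, h₂⟩ := h.integral_expansion hT hsT hL ((lam / (lam - 1)) • η) hκ
  refine ⟨min d₁ d₂, lt_min hd₁ hd₂, fun ε hε hεs => ?_⟩
  have a1 : |lam * ε| = lam * |ε| := by rw [abs_mul, abs_of_pos hlam.1]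
  have a2 : |ε - lam * ε| = (1 - lam) * |ε| := by
    rw [show ε - lam * ε = (1 - lam) * ε by ring, abs_mul, abs_of_pos (by linarith [hlam.2])]
  have a3 : lam * |ε| ≤ |ε| := mul_le_of_le_one_left (abs_nonneg _) hlam.2.le
  have a4 : (1 - lam) * |ε| ≤ |ε| :=
    mul_le_of_le_one_left (abs_nonneg _) (by linarith [hlam.1])
  have hmid : θ + lam * ε ∈ s := by
    refine h.ordConnected.uIcc_subset h.mem hεs (mem_uIcc.2 ?_)
    rcases le_total 0 ε with h0 | h0
    · exact Or.inl ⟨by nlinarith [hlam.1], by nlinarith [hlam.2]⟩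
    · exact Or.inr ⟨by nlinarith [hlam.2], by nlinarith [hlam.1]⟩
  have k1 := h₁ |ε| (hε.trans_le (min_le_left _ _)) θ h.mem (θ + lam * ε) hmid 0
    (by simp) (by simpa [a1] using a3) (by simp) (by simpa [a1] using a3)
  have k2 := h₂ |ε| (hε.trans_le (min_le_right _ _)) (θ + lam * ε) hmid (θ + ε) hεs ε
    (by simpa [a1] using a3) (by simp)
    (by rw [add_sub_cancel_left, abs_sub_comm, a2]; exact a4) (by simp)
  simp only [sub_zero, add_sub_cancel_left, sub_self, sub_sub, add_sub_add_left_eq_sub, a1, a2]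
    at k1 k2
  rw [← h.primitive_sum hT (hsT h.mem) hL η hlam.2 ε, needleIntegral, add_sub_add_comm]
  calc _ ≤ _ := abs_add_le _ _
    _ ≤ κ * |ε| ^ 2 * (lam * |ε|) + κ * |ε| ^ 2 * ((1 - lam) * |ε|) := add_le_add k1 k2
    _ = κ * |ε| ^ 3 := by ring

end Increment

/-! ### Signs of the leading coefficients. -/

lemma nonneg_of_forall_small {a b : ℝ} {d : ℝ} (hd : 0 < d)
    (h : ∀ ε, 0 < ε → ε < d → 0 ≤ a + b * ε) : 0 ≤ a := by
  have h1 : Tendsto (fun ε : ℝ => a + b * ε) (𝓝[>] 0) (𝓝 a) := by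
    have : Continuous fun ε : ℝ => a + b * ε := by fun_prop
    simpa using (this.tendsto 0).mono_left nhdsWithin_le_nhds
  refine ge_of_tendsto h1 ?_
  filter_upwards [Ioo_mem_nhdsGT hd] with ε hε using h ε hε.1 hε.2

lemma nonneg_coefficients {f : ℝ → ℝ} {a b : ℝ}
    (hexp : ∀ κ > 0, ∃ d > 0, ∀ ε, 0 < ε → ε < d →
      |f ε - (ε ^ 2 / 2 * a + ε ^ 3 / 6 * b)| ≤ κ * ε ^ 3)
    (hf : ∃ d > 0, ∀ ε, 0 < ε → ε < d → 0 ≤ f ε) : 0 ≤ a ∧ (a = 0 → 0 ≤ b) := by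
  obtain ⟨d₀, hd₀, h₀⟩ := hf
  constructor
  · obtain ⟨d, hd, h⟩ := hexp 1 one_pos
    -- With `κ = 1` the upper bound for `f ε` factors as `ε²/2 * (a + (b/3 + 2) ε)`.
    refine nonneg_of_forall_small (b := b / 3 + 2) (lt_min hd₀ hd) fun ε hε hεd => ?_
    have h1 := h₀ ε hε (hεd.trans_le (min_le_left _ _))
    have h2 := (abs_le.1 (h ε hε (hεd.trans_le (min_le_right _ _)))).2
    have h3 : 0 ≤ ε ^ 2 / 2 * (a + (b / 3 + 2) * ε) := by linarith
    exact nonneg_of_mul_nonneg_right h3 (by positivity)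
  · rintro rfl
    -- Here the small variable is the tolerance `κ`: for each `κ`, one small `ε` gives `b + 6 κ ≥
    -- 0`.
    refine nonneg_of_forall_small (b := 6) one_pos fun κ hκ _ => ?_
    obtain ⟨d, hd, h⟩ := hexp κ hκ
    have hm : 0 < min d₀ d := lt_min hd₀ hd
    have h1 := h₀ (min d₀ d / 2) (by linarith) (by linarith [min_le_left d₀ d])
    have h2 := (abs_le.1 (h (min d₀ d / 2) (by linarith) (by linarith [min_le_right d₀ d]))).2
    have h3 : 0 ≤ (min d₀ d / 2) ^ 3 / 6 * (b + 6 * κ) := by linarith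
    exact nonneg_of_mul_nonneg_right h3 (by positivity)

section Minimum

variable {n : ℕ} {T s : Set ℝ} {L : ℝ → Rn n → Rn n → ℝ} {xb : ℝ → Rn n} {θ t₀ t₁ : ℝ}

/-- The excess has nonnegative integral along every triangular variation with slopes bounded
by `δ` and support of length at most one. -/
def TentNonneg (L : ℝ → Rn n → Rn n → ℝ) (t₀ t₁ : ℝ) (xb : ℝ → Rn n) (δ : ℝ) : Prop :=
  ∀ (a b c : ℝ) (u v : Rn n), t₀ ≤ a → a < b → b < c → c ≤ t₁ → c - a ≤ 1 →
    (b - a) • u + (c - b) • v = 0 → ‖u‖ ≤ δ → ‖v‖ ≤ δ →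
    0 ≤ (∫ t in a..b, excess L xb (Icc t₀ t₁) t ((t - a) • u) u)
      + ∫ t in b..c, excess L xb (Icc t₀ t₁) t ((t - c) • v) v

/-- At interior points of `[p, q]` both derivatives are the ordinary one, so minimality, stated
along `[t₀, t₁]`, transfers to one-sided derivatives along `s`. -/
lemma integral_excess_congr {p q : ℝ} (hpq : p ≤ q) (hs : Icc p q ⊆ s)
    (hI : Icc p q ⊆ Icc t₀ t₁) (z : ℝ → Rn n) (u : Rn n) :
    ∫ t in p..q, excess L xb (Icc t₀ t₁) t (z t) u = ∫ t in p..q, excess L xb s t (z t) u := by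
  refine integral_congr_Ioo hpq fun t ht => ?_
  have h := Icc_mem_nhds ht.1 ht.2
  simp only [excess, derivWithin_of_mem_nhds (mem_of_superset h hs),
    derivWithin_of_mem_nhds (mem_of_superset h hI)]

lemma Degenerate.Q_one {lam : ℝ} {η : Rn n} (h : Degenerate L xb s θ lam η) :
    Q 1 L xb s θ lam η = 0 := by
  simp [Q, h.1, h.2]

lemma TriplyDiffAlong.nonneg_right (h : TriplyDiffAlong xb s θ) (hT : IsOpen T)
    (hsT : s ⊆ T) (hsI : s ⊆ Icc t₀ t₁) (hL : SmoothIntegrand T L) {δ : ℝ}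
    (hmin : TentNonneg L t₀ t₁ xb δ) {r : ℝ} (hr : 0 < r) (hrs : Icc θ (θ + r) ⊆ s)
    {η : Rn n} {lam : ℝ} (hlam : lam ∈ Ioo (0 : ℝ) 1) (hη : ‖η‖ ≤ δ)
    (hη' : ‖(lam / (lam - 1)) • η‖ ≤ δ) (hdeg : Degenerate L xb s θ lam η) :
    0 ≤ W L xb s θ lam η ∧ (W L xb s θ lam η = 0 → 0 ≤ G L xb s θ lam η) := by
  refine nonneg_coefficients (f := needleIntegral L xb s θ lam η) (fun κ hκ => ?_)
    ⟨min r 1, lt_min hr one_pos, fun ε hε hεr => ?_⟩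
  · obtain ⟨d, hd, h'⟩ := h.needleIntegral_expansion hT hsT hL η hlam hκ
    refine ⟨min d r, lt_min hd hr, fun ε hε hεd => ?_⟩
    have h1 := h' ε (by rw [abs_of_pos hε]; exact hεd.trans_le (min_le_left _ _))
      (hrs ⟨by linarith, by linarith [min_le_right d r]⟩)
    rwa [hdeg.Q_one, mul_zero, zero_add, abs_of_pos hε] at h1
  · have l1 : 0 < lam * ε := mul_pos hlam.1 hε
    have l2 : lam * ε < ε := mul_lt_of_lt_one_left hε hlam.2
    have hεr' : ε < r := hεr.trans_le (min_le_left _ _)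
    have hb : Icc θ (θ + ε) ⊆ s := (Icc_subset_Icc_right (by linarith)).trans hrs
    have s1 : Icc θ (θ + lam * ε) ⊆ s := (Icc_subset_Icc_right (by linarith)).trans hb
    have s2 : Icc (θ + lam * ε) (θ + ε) ⊆ s := (Icc_subset_Icc_left (by linarith)).trans hb
    have h1 := hmin θ (θ + lam * ε) (θ + ε) η ((lam / (lam - 1)) • η) (hsI h.mem).1
      (by linarith) (by linarith) (hsI (hb ⟨by linarith, le_rfl⟩)).2
      (by linarith [min_le_right r 1]) ?_ hη hη'
    · rwa [integral_excess_congr (by linarith) s1 (s1.trans hsI),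
        integral_excess_congr (by linarith) s2 (s2.trans hsI)] at h1
    · have h3 : lam - 1 ≠ 0 := by linarith [hlam.2]
      rw [smul_smul, ← add_smul]
      -- The tent closes up: `lam ε + (1 - lam) ε · lam / (lam - 1) = 0`.
      convert zero_smul ℝ η
      field_simp
      ring

lemma TriplyDiffAlong.nonneg_left (h : TriplyDiffAlong xb s θ) (hT : IsOpen T)
    (hsT : s ⊆ T) (hsI : s ⊆ Icc t₀ t₁) (hL : SmoothIntegrand T L) {δ : ℝ}
    (hmin : TentNonneg L t₀ t₁ xb δ) {r : ℝ} (hr : 0 < r) (hrs : Icc (θ - r) θ ⊆ s)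
    {η : Rn n} {lam : ℝ} (hlam : lam ∈ Ioo (0 : ℝ) 1) (hη : ‖η‖ ≤ δ)
    (hη' : ‖(lam / (lam - 1)) • η‖ ≤ δ) (hdeg : Degenerate L xb s θ lam η) :
    W L xb s θ lam η ≤ 0 ∧ (W L xb s θ lam η = 0 → 0 ≤ G L xb s θ lam η) := by
  have key : 0 ≤ -W L xb s θ lam η ∧ (-W L xb s θ lam η = 0 → 0 ≤ G L xb s θ lam η) := by
    -- At `-ε` both integrals run backwards, so the minus sign restores the true increment. In its
    -- expansion the `ε²` term changes sign and the `ε³` term does not.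
    refine nonneg_coefficients (f := fun ε => -needleIntegral L xb s θ lam η (-ε))
      (fun κ hκ => ?_) ⟨min r 1, lt_min hr one_pos, fun ε hε hεr => ?_⟩
    · obtain ⟨d, hd, h'⟩ := h.needleIntegral_expansion hT hsT hL η hlam hκ
      refine ⟨min d r, lt_min hd hr, fun ε hε hεd => ?_⟩
      have h1 := h' (-ε) (by rw [abs_neg, abs_of_pos hε]; exact hεd.trans_le (min_le_left _ _))
        (hrs ⟨by linarith [min_le_right d r], by linarith⟩)
      rw [hdeg.Q_one, mul_zero, zero_add, abs_neg, abs_of_pos hε, ← abs_neg] at h1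
      convert h1 using 2
      ring
    · have l1 : 0 < lam * ε := mul_pos hlam.1 hε
      have l2 : lam * ε < ε := mul_lt_of_lt_one_left hε hlam.2
      have hεr' : ε < r := hεr.trans_le (min_le_left _ _)
      have hb : Icc (θ + -ε) θ ⊆ s := (Icc_subset_Icc_left (by linarith)).trans hrs
      have s1 : Icc (θ + lam * -ε) θ ⊆ s := (Icc_subset_Icc_left (by linarith)).trans hb
      have s2 : Icc (θ + -ε) (θ + lam * -ε) ⊆ s := (Icc_subset_Icc_right (by linarith)).trans hb
      have h1 := hmin (θ + -ε) (θ + lam * -ε) θ ((lam / (lam - 1)) • η) η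
        (hsI (hb ⟨le_rfl, by linarith⟩)).1 (by linarith) (by linarith) (hsI h.mem).2
        (by linarith [min_le_right r 1]) ?_ hη' hη
      · rw [integral_excess_congr (by linarith) s1 (s1.trans hsI),
          integral_excess_congr (by linarith) s2 (s2.trans hsI)] at h1
        rw [needleIntegral, intervalIntegral.integral_symm (θ + lam * -ε) θ,
          intervalIntegral.integral_symm (θ + -ε) (θ + lam * -ε)]
        linarith
      · have h3 : lam - 1 ≠ 0 := by linarith [hlam.2]
        rw [smul_smul, ← add_smul]
        convert zero_smul ℝ η
        field_simp
        ring
  exact ⟨by linarith [key.1], fun h0 => key.2 (by rw [h0, neg_zero])⟩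

/-! ### From the hypotheses of the theorem to the common setting. -/

lemma TriplyDiffRight.along (hθ : θ ∈ Ico t₀ t₁) (h : TriplyDiffRight t₀ t₁ xb θ) :
    TriplyDiffAlong xb (Icc θ t₁) θ := by
  obtain ⟨α, hα, -, h'⟩ := h
  refine ⟨ordConnected_Icc, uniqueDiffOn_Icc hθ.2, ⟨le_rfl, hθ.2.le⟩, ?_,
    (h' θ ⟨le_rfl, by linarith⟩).2⟩
  filter_upwards [self_mem_nhdsWithin,
    mem_nhdsWithin_of_mem_nhds (Iio_mem_nhds (by linarith : θ < θ + α))] with t h1 h2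
    using (h' t ⟨h1.1, h2⟩).1

lemma TriplyDiffLeft.along (hθ : θ ∈ Ioc t₀ t₁) (h : TriplyDiffLeft t₀ t₁ xb θ) :
    TriplyDiffAlong xb (Icc t₀ θ) θ := by
  obtain ⟨α, hα, -, h'⟩ := h
  refine ⟨ordConnected_Icc, uniqueDiffOn_Icc hθ.1, ⟨hθ.1.le, le_rfl⟩, ?_,
    (h' θ ⟨by linarith, le_rfl⟩).2⟩
  filter_upwards [self_mem_nhdsWithin,
    mem_nhdsWithin_of_mem_nhds (Ioi_mem_nhds (by linarith : θ - α < θ))] with t h1 h2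
    using (h' t ⟨h2, h1.2⟩).1

lemma TriplyDiffAt.along (hθ : θ ∈ Ioo t₀ t₁) (h : TriplyDiffAt t₀ t₁ xb θ) :
    TriplyDiffAlong xb (Icc t₀ t₁) θ :=
  ⟨ordConnected_Icc, uniqueDiffOn_Icc (hθ.1.trans hθ.2), ⟨hθ.1.le, hθ.2.le⟩,
    h.1.filter_mono nhdsWithin_le_nhds, h.2.differentiableWithinAt⟩

lemma WeakLocalMin.exists_tentNonneg (hT : IsOpen T) (ht : t₀ < t₁) (hI : Icc t₀ t₁ ⊆ T)
    (hL : SmoothIntegrand T L) {x₀ x₁ : Rn n} (h : WeakLocalMin L t₀ t₁ x₀ x₁ xb) :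
    ∃ δ > 0, TentNonneg L t₀ t₁ xb δ := by
  obtain ⟨hadm, δ, hδ, hmin⟩ := h
  exact ⟨δ, hδ, fun a b c u v ha hab hbc hc hac huv hu hv =>
    integral_excess_tent_nonneg hT ht hI (ContDiffOn.of_le hL.1 (by norm_num)) hadm hδ hmin ha hab
      hbc hc hac huv hu hv⟩

end Minimum

end CalcVar

end

theorem theorem3p5 (n : ℕ) (T : Set ℝ) (hT : IsOpen T) (hTi : T.OrdConnected)
    (t₀ t₁ : ℝ) (ht : t₀ < t₁) (hI : Set.Icc t₀ t₁ ⊆ T)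
    (L : ℝ → CalcVar.Rn n → CalcVar.Rn n → ℝ) (hL : CalcVar.SmoothIntegrand T L)
    (x₀ x₁ : CalcVar.Rn n) (xb : ℝ → CalcVar.Rn n)
    (hmin : CalcVar.WeakLocalMin L t₀ t₁ x₀ x₁ xb) :
    ∃ δ > 0,
      -- degeneracy on the right at a point
      (∀ θ ∈ Set.Ico t₀ t₁, CalcVar.TriplyDiffRight t₀ t₁ xb θ →
        ∀ (η : CalcVar.Rn n) (lam : ℝ), lam ∈ Set.Ioo (0 : ℝ) 1 →
          ‖η‖ ≤ δ → ‖(lam / (lam - 1)) • η‖ ≤ δ →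
          CalcVar.Degenerate L xb (Set.Icc θ t₁) θ lam η →
          CalcVar.W L xb (Set.Icc θ t₁) θ lam η = 0 →
          0 ≤ CalcVar.G L xb (Set.Icc θ t₁) θ lam η) ∧
      -- degeneracy on the left at a point
      (∀ θ ∈ Set.Ioc t₀ t₁, CalcVar.TriplyDiffLeft t₀ t₁ xb θ →
        ∀ (η : CalcVar.Rn n) (lam : ℝ), lam ∈ Set.Ioo (0 : ℝ) 1 →
          ‖η‖ ≤ δ → ‖(lam / (lam - 1)) • η‖ ≤ δ →
          CalcVar.Degenerate L xb (Set.Icc t₀ θ) θ lam η →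
          CalcVar.W L xb (Set.Icc t₀ θ) θ lam η = 0 →
          0 ≤ CalcVar.G L xb (Set.Icc t₀ θ) θ lam η) ∧
      -- degeneracy at an interior point (two-sided)
      (∀ θ ∈ Set.Ioo t₀ t₁, CalcVar.TriplyDiffAt t₀ t₁ xb θ →
        ∀ (η : CalcVar.Rn n) (lam : ℝ), lam ∈ Set.Ioo (0 : ℝ) 1 →
          ‖η‖ ≤ δ → ‖(lam / (lam - 1)) • η‖ ≤ δ →
          CalcVar.Degenerate L xb (Set.Icc t₀ t₁) θ lam η →
          0 ≤ CalcVar.G L xb (Set.Icc t₀ t₁) θ lam η) := by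
  obtain ⟨δ, hδ, htent⟩ := hmin.exists_tentNonneg hT ht hI hL
  refine ⟨δ, hδ, ?_, ?_, ?_⟩
  · intro θ hθ hx η lam hlam hη hη' hdeg hW
    have hsI : Icc θ t₁ ⊆ Icc t₀ t₁ := Icc_subset_Icc_left hθ.1
    exact ((hx.along hθ).nonneg_right hT (hsI.trans hI) hsI hL htent (sub_pos.2 hθ.2)
      (Icc_subset_Icc_right (by linarith)) hlam hη hη' hdeg).2 hW
  · intro θ hθ hx η lam hlam hη hη' hdeg hW
    have hsI : Icc t₀ θ ⊆ Icc t₀ t₁ := Icc_subset_Icc_right hθ.2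
    exact ((hx.along hθ).nonneg_left hT (hsI.trans hI) hsI hL htent (sub_pos.2 hθ.1)
      (Icc_subset_Icc_left (by linarith)) hlam hη hη' hdeg).2 hW
  · intro θ hθ hx η lam hlam hη hη' hdeg
    have hr := (hx.along hθ).nonneg_right hT hI Subset.rfl hL htent (sub_pos.2 hθ.2)
      (Icc_subset_Icc hθ.1.le (by linarith)) hlam hη hη' hdeg
    have hl := (hx.along hθ).nonneg_left hT hI Subset.rfl hL htent (sub_pos.2 hθ.1)
      (Icc_subset_Icc (by linarith) hθ.2.le) hlam hη hη' hdeg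
    -- The variations on the two sides force `W ≥ 0` and `W ≤ 0`.
    exact hr.2 (le_antisymm hl.1 hr.1)
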